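/- Let $q\ge 2$ be an integer, let $T=T_{q+1}$ be the homogeneous tree of valency $q+1$ with a distinguished vertex $v_0$, and let $\partial T$ be its space of ends with its Borel $\sigma$-algebra. The infinite paths of the dynamic graph of $(T,v_0)$ are identified with the infinite walks $(w_n)_{n\ge 0}$ in $T$ with $w_0=v_0$. A Borel probability measure $\mu$ on the space of these paths is called central if, for every vertex $x$ of $T$ and every $n$, all walks of length $n$ from $v_0$ to $x$ are the initial segment of the random path with the same $\mu$-probability; it is called ergodic central if it is an extreme point of the set of central measures. For $\omega\in\partial T$ and $r\in[0,1]$ let $\lambda_{\omega,r}$ be the law of the Markov chain on $T$ started at $v_0$ which moves from each vertex $x$ to the neighbour of $x$ lying between $x$ and $\omega$ with probability $r$, and to each of the other $q$ neighbours with probability $\frac{1-r}{q}$. Let $\theta$ be the harmonic measure on $\partial T$ seen from $v_0$, that is, the law of the limit end of the simple random walk on $T$ started at $v_0$. For $\omega_0\neq\omega$ in $\partial T$ let $\ell(\omega_0,\omega)$ be the number of edges in the common part of the rays $[v_0,\omega_0\rangle$ and $[v_0,\omega\rangle$. Let $\omega_0\in\partial T$ and $0\le r<\frac12$. Then every $\lambda_{\omega,1-r}$,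 $\omega\in\partial T$, is an ergodic central measure, the map $\omega\mapsto\lambda_{\omega,1-r}$ is measurable, and there is exactly one Borel probability measure $\rho_{\omega_0,r}$ on $\partial T$ such that $$\lambda_{\omega_0,r}=\int_{\partial T}\lambda_{\omega,1-r}\,\rho_{\omega_0,r}(d\omega).$$ The measure $\rho_{\omega_0,r}$ is absolutely continuous with respect to $\theta$, and for $\theta$-almost every $\omega$ $$\frac{d\rho_{\omega_0,r}}{d\theta}(\omega)=\frac{(1-2r)(q+1)}{q-qr-r}\left(\frac{qr}{1-r}\right)^{\ell(\omega_0,\omega)},$$ where $0^0=1$. -/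

import Mathlib

open MeasureTheory ProbabilityTheory Filter

namespace HomTree

variable {V : Type*}

/-- `G` is the homogeneous tree of valency `q + 1`. -/
class IsHomogeneousTree (G : SimpleGraph V) [G.LocallyFinite] (q : ℕ) : Prop where
  isTree : G.IsTree
  regular : G.IsRegularOfDegree (q + 1)

/-- The space of ends of a tree `G`, each end being represented by the unique geodesic ray
from the base vertex `v₀` which represents it. As a subspace of `ℕ → V` with `V` discrete, it
carries its usual topology and Borel structure. -/
abbrev Boundary (G : SimpleGraph V) (v₀ : V) : Type _ :=
  {ω : ℕ → V // ω 0 = v₀ ∧ (∀ n, G.Adj (ω n) (ω (n + 1))) ∧ ∀ n, G.dist v₀ (ω n) = n}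

/-- `y` is the neighbour of `x` which lies between `x` and the end `ω`: it lies on the geodesic
from `x` to `ω n` for all large `n`. -/
def IsToward (G : SimpleGraph V) {v₀ : V} (ω : Boundary G v₀) (x y : V) : Prop :=
  G.Adj x y ∧ ∀ᶠ n in atTop, G.dist x (ω.1 n) = G.dist y (ω.1 n) + 1

theorem dist_adj_le {G : SimpleGraph V} (hG : G.Connected) {x y z : V} (h : G.Adj y z) :
    G.dist x z ≤ G.dist x y + 1 := by
  have h1 := hG.dist_triangle (u := x) (v := y) (w := z)
  rw [SimpleGraph.dist_eq_one_iff_adj.2 h] at h1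
  exact h1

theorem exists_isToward {G : SimpleGraph V} (hG : G.Connected) {v₀ : V} (ω : Boundary G v₀)
    (x : V) : ∃ y, IsToward G ω x y := by
  obtain ⟨ω, h0, hadj, hdist⟩ := ω
  have hstep : ∀ z n, G.dist z (ω (n + 1)) ≤ G.dist z (ω n) + 1 :=
    fun z n => dist_adj_le hG (hadj n)
  have hlow : ∀ n, n ≤ G.dist v₀ x + G.dist x (ω n) := fun n => by
    have := hG.dist_triangle (u := v₀) (v := x) (w := ω n)
    rwa [hdist n] at this
  -- the nonnegative quantity `G.dist x (ω n) - n` is eventually constant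
  have hmin : ∃ N, ∀ n, N ≤ n → G.dist x (ω n) + N = G.dist x (ω N) + n := by
    obtain ⟨N, hN⟩ : ∃ N, ∀ n,
        G.dist v₀ x + G.dist x (ω N) - N ≤ G.dist v₀ x + G.dist x (ω n) - n :=
      ⟨_, fun n => Function.argmin_le (fun n => G.dist v₀ x + G.dist x (ω n) - n) n⟩
    refine ⟨N, fun n hn => ?_⟩
    have hle : ∀ k, G.dist x (ω (N + k)) ≤ G.dist x (ω N) + k := fun k => by
      induction k with
      | zero => simp
      | succ k ih => have := hstep x (N + k); rw [← add_assoc]; omega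
    obtain ⟨k, rfl⟩ := Nat.exists_eq_add_of_le hn
    have h1 := hle k
    have h2 := hN (N + k)
    have h3 := hlow N
    have h4 := hlow (N + k)
    omega
  obtain ⟨N₀, hN₀⟩ := hmin
  obtain ⟨N, hN, hpos⟩ : ∃ N, (∀ n, N ≤ n → G.dist x (ω n) + N = G.dist x (ω N) + n) ∧
      1 ≤ G.dist x (ω N) := by
    refine ⟨N₀ + 1, fun n hn => ?_, ?_⟩
    · have h1 := hN₀ n (by omega)
      have h2 := hN₀ (N₀ + 1) (by omega)
      omega
    · have h2 := hN₀ (N₀ + 1) (by omega)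
      omega
  obtain ⟨p, hp⟩ := hG.exists_walk_length_eq_dist x (ω N)
  cases p with
  | nil => simp at hpos
  | @cons _ y _ h p =>
    refine ⟨y, h, eventually_atTop.2 ⟨N, fun n hn => ?_⟩⟩
    have hyN : G.dist y (ω N) + 1 ≤ G.dist x (ω N) := by
      rw [← hp, SimpleGraph.Walk.length_cons]
      exact Nat.succ_le_succ (SimpleGraph.dist_le p)
    have hle : ∀ k, G.dist y (ω (N + k)) ≤ G.dist y (ω N) + k := fun k => by
      induction k with
      | zero => simp
      | succ k ih => have := hstep y (N + k); rw [← add_assoc]; omega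
    have hxy : G.dist x (ω n) ≤ G.dist y (ω n) + 1 := by
      have h1 := dist_adj_le hG (x := ω n) h.symm
      rwa [G.dist_comm, G.dist_comm (u := ω n)] at h1
    have h1 := hN n hn
    obtain ⟨k, rfl⟩ := Nat.exists_eq_add_of_le hn
    have h2 := hle k
    change G.dist x (ω (N + k)) = G.dist y (ω (N + k)) + 1
    omega

theorem isToward_unique {G : SimpleGraph V} (hG : G.IsTree) {v₀ : V} {ω : Boundary G v₀}
    {x y z : V} (hy : IsToward G ω x y) (hz : IsToward G ω x z) : y = z := by
  obtain ⟨n, h1, h2⟩ := (hy.2.and hz.2).exists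
  obtain ⟨p, hp⟩ := hG.connected.exists_walk_length_eq_dist y (ω.1 n)
  obtain ⟨p', hp'⟩ := hG.connected.exists_walk_length_eq_dist z (ω.1 n)
  have e := (hG.existsUnique_path x (ω.1 n)).unique
    ((p.cons hy.1).isPath_of_length_eq_dist (by simp [hp, h1]))
    ((p'.cons hz.1).isPath_of_length_eq_dist (by simp [hp', h2]))
  have := congrArg (fun w => w.getVert 1) e
  simpa using this

open Classical in
/-- Transition probability from `x` to `y`: it is `r` if the edge is `ω`-directed, and
`(1 - r) / q` if it is any other edge starting at `x`. -/
noncomputable def stepProb (G : SimpleGraph V) (q : ℕ) {v₀ : V} (ω : Boundary G v₀)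
    (r : unitInterval) (x y : V) : ENNReal :=
  if G.Adj x y then
    if IsToward G ω x y then ENNReal.ofReal r else ENNReal.ofReal ((1 - r) / q)
  else 0

theorem sum_stepProb (G : SimpleGraph V) [G.LocallyFinite] {q : ℕ} (hq : 2 ≤ q)
    [hG : IsHomogeneousTree G q] {v₀ : V} (ω : Boundary G v₀) (r : unitInterval) (x : V) :
    ∑ y ∈ G.neighborFinset x, stepProb G q ω r x y = 1 := by
  classical
  obtain ⟨z, hz⟩ := exists_isToward hG.isTree.connected ω x
  have hmem : z ∈ G.neighborFinset x := by simpa using hz.1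
  have hr0 : (0 : ℝ) ≤ 1 - r := sub_nonneg.2 r.2.2
  rw [← Finset.add_sum_erase _ _ hmem]
  have h1 : ∀ y ∈ (G.neighborFinset x).erase z,
      stepProb G q ω r x y = ENNReal.ofReal ((1 - r) / q) := fun y hy => by
    rw [Finset.mem_erase, SimpleGraph.mem_neighborFinset] at hy
    rw [stepProb, if_pos hy.2, if_neg fun h => hy.1 (isToward_unique hG.isTree h hz)]
  have hcard : ((G.neighborFinset x).erase z).card = q := by
    rw [Finset.card_erase_of_mem hmem, SimpleGraph.card_neighborFinset_eq_degree,
      hG.regular x, Nat.add_sub_cancel]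
  have hq' : (q : ℝ) ≠ 0 := Nat.cast_ne_zero.2 (by omega)
  rw [Finset.sum_congr rfl h1, Finset.sum_const, hcard, stepProb, if_pos hz.1, if_pos hz,
    ← ENNReal.ofReal_nsmul, ← ENNReal.ofReal_add r.2.1 (by positivity), nsmul_eq_mul,
    mul_div_cancel₀ _ hq']
  simp

/-- The one-step transition law at `x` of the chain defining `λ_{ω,r}`. -/
noncomputable def stepLaw (G : SimpleGraph V) [G.LocallyFinite] {q : ℕ} (hq : 2 ≤ q)
    [IsHomogeneousTree G q] {v₀ : V} (ω : Boundary G v₀) (r : unitInterval) (x : V) : PMF V :=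
  PMF.ofFinset (stepProb G q ω r x) (G.neighborFinset x) (sum_stepProb G hq ω r x)
    (fun y hy => by
      rw [SimpleGraph.mem_neighborFinset] at hy
      rw [stepProb, if_neg hy])

/-- The one-step transition law at `x` of the simple random walk. -/
noncomputable def simpleStepLaw (G : SimpleGraph V) [G.LocallyFinite] (q : ℕ)
    [hG : IsHomogeneousTree G q] (x : V) : PMF V :=
  PMF.uniformOfFinset (G.neighborFinset x) (by
    rw [← Finset.card_pos, SimpleGraph.card_neighborFinset_eq_degree, hG.regular x]
    exact Nat.succ_pos q)

section Markov

variable [MeasurableSpace V] [DiscreteMeasurableSpace V]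

/-- The transition kernel from histories up to time `n` to the position at time `n + 1` of the
time-homogeneous Markov chain with one-step laws `p`. -/
noncomputable def chainKernel (p : V → PMF V) (n : ℕ) :
    Kernel ((_i : Finset.Iic n) → V) V where
  toFun h := (p (h ⟨n, Finset.mem_Iic.2 le_rfl⟩)).toMeasure
  measurable' :=
    (Measurable.of_discrete (f := fun x : V => (p x).toMeasure)).comp (measurable_pi_apply _)

instance (p : V → PMF V) (n : ℕ) : IsMarkovKernel (chainKernel p n) :=
  ⟨fun _ => PMF.toMeasure.isProbabilityMeasure _⟩

/-- The law on trajectories `ℕ → V` of the Markov chain started at `v₀` with one-step laws `p`. -/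
noncomputable def chainLaw (p : V → PMF V) (v₀ : V) : Measure (ℕ → V) :=
  Kernel.trajMeasure (X := fun _ => V) (Measure.dirac v₀) (chainKernel p)

end Markov

/-- The infinite walks in `G` starting at `v₀`. An infinite path in the dynamic graph of `G`
started at its root is the sequence `(n, w n)` for such a walk `w`, so this is its path space. -/
def pathSpace (G : SimpleGraph V) (v₀ : V) : Set (ℕ → V) :=
  {w | w 0 = v₀ ∧ ∀ n, G.Adj (w n) (w (n + 1))}

/-- The infinite paths that start with the finite path `p`. -/
def cylinder {G : SimpleGraph V} {v₀ x : V} (p : G.Walk v₀ x) : Set (ℕ → V) :=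
  {w | ∀ i ≤ p.length, w i = p.getVert i}

/-- Central measures: probability measures carried by the path space such that, for every vertex
`(n, x)` of the dynamic graph, all finite paths from the root to `(n, x)` have the same mass. -/
structure IsCentral [MeasurableSpace V] (G : SimpleGraph V) (v₀ : V) (μ : Measure (ℕ → V)) :
    Prop where
  isProbabilityMeasure : IsProbabilityMeasure μ
  ae_mem : ∀ᵐ w ∂μ, w ∈ pathSpace G v₀
  uniform : ∀ (x : V) (p p' : G.Walk v₀ x), p.length = p'.length →
    μ (cylinder p) = μ (cylinder p')

/-- Ergodic central measures: extreme points of the set of central measures. -/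
def IsErgodicCentral [MeasurableSpace V] (G : SimpleGraph V) (v₀ : V) (μ : Measure (ℕ → V)) :
    Prop :=
  μ ∈ Set.extremePoints NNReal {ν : Measure (ℕ → V) | IsCentral G v₀ ν}

/-- The sequence `w` converges to the end `ω`: for each `m`, the geodesic from `v₀` to `w i` has,
for all large `i`, at least its first `m` edges in common with the ray from `v₀` to `ω`. -/
def ConvergesTo {G : SimpleGraph V} {v₀ : V} (w : ℕ → V) (ω : Boundary G v₀) : Prop :=
  ∀ m, ∀ᶠ i in atTop, G.dist v₀ (ω.1 m) + G.dist (ω.1 m) (w i) = G.dist v₀ (w i)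

/-- The length of the common part of the rays from `v₀` to `ω₀` and to `ω`, for `ω ≠ ω₀`. -/
noncomputable def commonLength {G : SimpleGraph V} {v₀ : V} (ω₀ ω : Boundary G v₀) : ℕ :=
  sSup {n | ∀ i ≤ n, ω₀.1 i = ω.1 i}

section Measures

variable [MeasurableSpace V] [DiscreteMeasurableSpace V] (G : SimpleGraph V) [G.LocallyFinite]

/-- The measure `λ_{ω,r}`. -/
noncomputable def lam {q : ℕ} (hq : 2 ≤ q) [IsHomogeneousTree G q] {v₀ : V} (ω : Boundary G v₀)
    (r : unitInterval) : Measure (ℕ → V) :=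
  chainLaw (stepLaw G hq ω r) v₀

/-- The harmonic measure on the space of ends seen from `v₀`: the law of the limit end of the
simple random walk started at `v₀` (on the set of trajectories which converge to an end). -/
noncomputable def harmonicMeasure (q : ℕ) [IsHomogeneousTree G q] (v₀ : V) :
    Measure (Boundary G v₀) :=
  ((chainLaw (simpleStepLaw G q) v₀).comap
    (Subtype.val : {w : ℕ → V // ∃ ω : Boundary G v₀, ConvergesTo w ω} → ℕ → V)).map
      (fun w => w.2.choose)

/-- `ρ` is a probability measure on the space of ends and
`λ_{ω₀,r} = ∫ λ_{ω,1-r} ρ(dω)`. -/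
structure IsDecomposition {q : ℕ} (hq : 2 ≤ q) [IsHomogeneousTree G q] {v₀ : V}
    (ω₀ : Boundary G v₀) (r : unitInterval) (ρ : Measure (Boundary G v₀)) : Prop where
  isProbabilityMeasure : IsProbabilityMeasure ρ
  eq_lintegral : ∀ A : Set (ℕ → V), MeasurableSet A →
    lam G hq ω₀ r A = ∫⁻ ω, lam G hq ω (unitInterval.symm r) A ∂ρ

end Measures

end HomTree

/-!
Write `s = 1 - r > 1 / 2`. The probability which `λ_{ω,s}` gives to a finite path depends only on
the numbers of its steps towards `ω` and away from it, and these are determined by the length of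
the path and the value at its end point of the Busemann function of `ω`
(`lam_initialCylinder_eq`); hence `λ_{ω,s}` is central.

*Convergence.* Exponential moments of the Busemann function decay geometrically along the walk, so
that by a Borel-Cantelli argument `λ_{ω,s}`-almost every trajectory converges to `ω`
(`ae_convergesTo`). A measure `ρ` with `λ_{ω₀,r} = ∫ λ_{ω,s} ρ(dω)` is therefore the law of the
limit end under `λ_{ω₀,r}` (`IsDecomposition.apply_eq`), which shows uniqueness.

*Decomposition.* The uniform measure `θ` on the ends is constructed from the walk moving outward
from `v₀`, and `ρ` is the measure with the asserted density with respect to `θ`. Because the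
product of the probabilities of a step towards the end and a step away from it is the same for `r`
and `s`, it is enough to compare the two sides on geodesics starting at `v₀`
(`isDecomposition_of_geodesic`), where one can argue by induction on the length: lengthening a
geodesic by one edge changes the integral by an amount which depends only on the mass `ρ` gives to
the ends behind that edge (`lintegral_lam_succ`), and this mass is given by a geometric series
(`decompositionMeasure_shadow_ray`, `decompositionMeasure_shadow_branch`). The simple random walk is
`λ_{ω₀,r}` for `r = 1 / (q + 1)`, and then the density is `1`; so the harmonic measure is `θ`
(`harmonicMeasure_eq_uniformEnds`).

*Ergodicity.* If a central measure `ν` is bounded by a multiple of `λ_{ω,s}`, then the quotient of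
the two masses of a path is a bounded function of the length and the end point of the path which is
space-time harmonic for the walk. Such a function is constant (`IsSpaceTimeHarmonic.eq_const`). It
takes equal values at two vertices whose paths to `ω` merge after the same number of steps, since
the largest difference over pairs merging after `j` steps is a bounded subharmonic function of `j`
vanishing at `0`, for a walk with drift to `0`. It is thus a function of the numbers of steps
towards `ω` and away from it, and a bounded harmonic function of these is constant by the argument
of Choquet and Deny (`eq_of_bounded_harmonic`). For `s = 1` the walk is deterministic, and the
claim is clear.
-/

namespace HomTree

variable {V : Type*}

/-! ### Geometry of trees and ends -/

section Geometry

variable {G : SimpleGraph V}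

/-- In a tree, at most one neighbour of `y` is closer to `v` than `y`. -/
theorem eq_of_adj_of_dist_eq (hG : G.IsTree) {v y a b : V} (ha : G.Adj y a) (hb : G.Adj y b)
    (h1 : G.dist y v = G.dist a v + 1) (h2 : G.dist y v = G.dist b v + 1) : a = b := by
  obtain ⟨p, hp⟩ := hG.connected.exists_walk_length_eq_dist a v
  obtain ⟨p', hp'⟩ := hG.connected.exists_walk_length_eq_dist b v
  have e := (hG.existsUnique_path y v).unique
    ((p.cons ha).isPath_of_length_eq_dist (by simp [hp, h1]))
    ((p'.cons hb).isPath_of_length_eq_dist (by simp [hp', h2]))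
  simpa using congrArg (fun w => w.getVert 1) e

theorem dist_adj_dichotomy (hG : G.IsTree) (v : V) {x y : V} (h : G.Adj x y) :
    G.dist x v = G.dist y v + 1 ∨ G.dist y v = G.dist x v + 1 := by
  rw [G.dist_comm (u := x), G.dist_comm (u := y)]
  exact hG.dist_eq_dist_add_one_of_adj v h

theorem exists_adj_dist (hG : G.Connected) {x y : V} {n : ℕ} (h : G.dist x y = n + 1) :
    ∃ z, G.Adj x z ∧ G.dist z y = n := by
  obtain ⟨p, hp⟩ := hG.exists_walk_length_eq_dist x y
  cases p with
  | nil => simp at h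
  | @cons _ z _ hz p =>
    refine ⟨z, hz, le_antisymm ?_ ?_⟩
    · have := SimpleGraph.dist_le p
      simp only [SimpleGraph.Walk.length_cons] at hp
      omega
    · have := dist_adj_le hG (x := y) hz.symm
      rw [G.dist_comm (u := y), G.dist_comm (u := y)] at this
      omega

/-- Geodesics in a tree which move away from `v` at their first step do so for ever. -/
theorem dist_eq_add_of_step (hG : G.IsTree) {v : V} :
    ∀ (n : ℕ) {y t z : V}, G.Adj y t → G.dist t v = G.dist y v + 1 →
      G.dist y z = G.dist t z + 1 → G.dist t z = n → G.dist z v = G.dist y v + G.dist y z := by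
  intro n
  induction n with
  | zero =>
    intro y t z _ h1 h2 h3
    have : t = z := hG.connected.dist_eq_zero_iff.1 h3
    subst this
    omega
  | succ n ih =>
    intro y t z h h1 h2 h3
    obtain ⟨t', ht', hd⟩ := exists_adj_dist hG.connected h3
    rcases dist_adj_dichotomy hG v ht' with h4 | h4
    · have : t' = y := eq_of_adj_of_dist_eq hG ht' h.symm h4 h1
      subst this
      omega
    · have := ih ht' h4 (by omega) hd
      omega

/-- The vertex at given distance on a geodesic of a tree is unique. -/
theorem eq_of_between (hG : G.IsTree) {v z : V} :
    ∀ (n : ℕ) {y y' : V}, G.dist y z = n → G.dist v y + G.dist y z = G.dist v z →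
      G.dist v y' + G.dist y' z = G.dist v z → G.dist v y = G.dist v y' → y = y' := by
  intro n
  induction n with
  | zero =>
    intro y y' h0 h1 h2 h3
    have e1 : y = z := hG.connected.dist_eq_zero_iff.1 h0
    have e2 : y' = z := hG.connected.dist_eq_zero_iff.1 (by omega)
    rw [e1, e2]
  | succ n ih =>
    intro y y' h0 h1 h2 h3
    obtain ⟨a, ha, hda⟩ := exists_adj_dist hG.connected h0
    obtain ⟨b, hb, hdb⟩ := exists_adj_dist hG.connected
      (show G.dist y' z = n + 1 by omega)
    have key : ∀ {y a : V}, G.Adj y a → G.dist a z + 1 = G.dist y z →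
        G.dist v y + G.dist y z = G.dist v z → G.dist v a = G.dist v y + 1 := by
      intro y a ha h h'
      have h4 := dist_adj_le hG.connected (x := v) ha
      have h5 := hG.connected.dist_triangle (u := v) (v := a) (w := z)
      omega
    have k1 := key ha (by omega) h1
    have k2 := key hb (by omega) h2
    have : a = b := ih hda (by omega) (by omega) (by omega)
    subst this
    refine eq_of_adj_of_dist_eq hG ha.symm hb.symm (v := v) ?_ ?_ <;>
    · rw [G.dist_comm, G.dist_comm (v := v)]; omega

variable {v₀ : V}

theorem Boundary.dist_le (hG : G.Connected) (ω : Boundary G v₀) (m k : ℕ) :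
    G.dist (ω.1 m) (ω.1 (m + k)) = k := by
  apply le_antisymm
  · induction k with
    | zero => simp
    | succ k ih =>
      have := dist_adj_le hG (x := ω.1 m) (ω.2.2.1 (m + k))
      rw [← add_assoc]
      omega
  · have h1 := hG.dist_triangle (u := v₀) (v := ω.1 m) (w := ω.1 (m + k))
    have h2 := ω.2.2.2 m
    have h3 := ω.2.2.2 (m + k)
    omega

theorem isToward_ray (hG : G.Connected) (ω : Boundary G v₀) (m : ℕ) :
    IsToward G ω (ω.1 m) (ω.1 (m + 1)) := by
  refine ⟨ω.2.2.1 m, eventually_atTop.2 ⟨m + 1, fun n hn => ?_⟩⟩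
  obtain ⟨k, rfl⟩ := Nat.exists_eq_add_of_le hn
  rw [ω.dist_le hG (m + 1) k]
  have := ω.dist_le hG m (k + 1)
  rwa [show m + (k + 1) = m + 1 + k by ring] at this

/-- The neighbour of `x` in the direction of the end `ω`. -/
noncomputable def towardStep (hG : G.Connected) (ω : Boundary G v₀) (x : V) : V :=
  (exists_isToward hG ω x).choose

theorem isToward_towardStep (hG : G.Connected) (ω : Boundary G v₀) (x : V) :
    IsToward G ω x (towardStep hG ω x) := (exists_isToward hG ω x).choose_spec

theorem isToward_iff (hG : G.IsTree) {ω : Boundary G v₀} {x y : V} :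
    IsToward G ω x y ↔ y = towardStep hG.connected ω x :=
  ⟨fun h => isToward_unique hG h (isToward_towardStep _ ω x),
    fun h => h ▸ isToward_towardStep _ ω x⟩

theorem towardStep_ray (hG : G.IsTree) (ω : Boundary G v₀) (m : ℕ) :
    towardStep hG.connected ω (ω.1 m) = ω.1 (m + 1) :=
  ((isToward_iff hG).1 (isToward_ray hG.connected ω m)).symm

/-- If the edge from `x` to `y` does not point to `ω`, then the reversed edge does. -/
theorem isToward_symm (hG : G.IsTree) {ω : Boundary G v₀} {x y : V} (h : G.Adj x y)
    (hxy : ¬ IsToward G ω x y) : IsToward G ω y x := by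
  have ht := isToward_towardStep hG.connected ω x
  have hne : towardStep hG.connected ω x ≠ y := fun e => hxy (e ▸ ht)
  refine ⟨h.symm, ht.2.mono fun n hn => ?_⟩
  rcases dist_adj_dichotomy hG (ω.1 n) h with h1 | h1
  · exact absurd (eq_of_adj_of_dist_eq hG ht.1 h hn h1) hne
  · exact h1

/-- The quantity `G.dist x (ω n) - n` is eventually constant. -/
theorem exists_busemann (hG : G.IsTree) (ω : Boundary G v₀) (x : V) :
    ∃ c : ℤ, ∀ᶠ n in atTop, (G.dist x (ω.1 n) : ℤ) = n + c := by
  obtain ⟨p⟩ := hG.connected.preconnected v₀ x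
  induction p using SimpleGraph.Walk.concatRec with
  | Hnil => exact ⟨0, Eventually.of_forall fun n => by simp [ω.2.2.2 n]⟩
  | Hconcat p h ih =>
    rename_i y z
    obtain ⟨c, hc⟩ := ih ω
    by_cases hd : IsToward G ω y z
    · exact ⟨c - 1, (hc.and hd.2).mono fun n hn => by omega⟩
    · exact ⟨c + 1, (hc.and (isToward_symm hG h hd).2).mono fun n hn => by omega⟩

/-- The Busemann function of the end `ω`, normalized to vanish at `v₀`: the value of
`G.dist x (ω n) - n` for all large `n`. -/
noncomputable def busemann (hG : G.IsTree) (ω : Boundary G v₀) (x : V) : ℤ :=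
  (exists_busemann hG ω x).choose

theorem busemann_spec (hG : G.IsTree) (ω : Boundary G v₀) (x : V) :
    ∀ᶠ n in atTop, (G.dist x (ω.1 n) : ℤ) = n + busemann hG ω x :=
  (exists_busemann hG ω x).choose_spec

theorem busemann_base (hG : G.IsTree) (ω : Boundary G v₀) : busemann hG ω v₀ = 0 := by
  obtain ⟨n, hn⟩ := (busemann_spec hG ω v₀).exists
  rw [ω.2.2.2 n] at hn
  omega

theorem busemann_of_isToward (hG : G.IsTree) {ω : Boundary G v₀} {x y : V}
    (h : IsToward G ω x y) : busemann hG ω y = busemann hG ω x - 1 := by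
  obtain ⟨n, h1, h2, h3⟩ :=
    (h.2.and ((busemann_spec hG ω x).and (busemann_spec hG ω y))).exists
  omega

theorem busemann_of_not_isToward (hG : G.IsTree) {ω : Boundary G v₀} {x y : V} (ha : G.Adj x y)
    (h : ¬ IsToward G ω x y) : busemann hG ω y = busemann hG ω x + 1 := by
  have := busemann_of_isToward hG (isToward_symm hG ha h)
  omega

/-- A vertex deep inside the horoballs centred at `ω` is separated from `v₀` by a long initial
piece of the ray to `ω`. -/
theorem between_of_busemann_lt (hG : G.IsTree) {ω : Boundary G v₀} {x : V} {m : ℕ}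
    (h : busemann hG ω x < -m) :
    G.dist v₀ (ω.1 m) + G.dist (ω.1 m) x = G.dist v₀ x := by
  rcases dist_adj_dichotomy hG x (ω.2.2.1 m) with h1 | h1
  · have hm := ω.2.2.2 m
    have hm1 := ω.2.2.2 (m + 1)
    rw [G.dist_comm] at hm hm1
    have := dist_eq_add_of_step hG (v := x) m (ω.2.2.1 m).symm h1 (z := v₀) (by omega) hm
    rw [hm1] at this
    rw [G.dist_comm (u := v₀) (v := ω.1 m)]
    omega
  · obtain ⟨n, hn, hmn⟩ := ((busemann_spec hG ω x).and (eventually_ge_atTop (m + 1))).exists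
    obtain ⟨k, rfl⟩ := Nat.exists_eq_add_of_le hmn
    have e1 := ω.dist_le hG.connected (m + 1) k
    have e2 := ω.dist_le hG.connected m (k + 1)
    rw [show m + (k + 1) = m + 1 + k by ring] at e2
    have := dist_eq_add_of_step hG k (ω.2.2.1 m) h1 (by omega) e1
    rw [G.dist_comm] at this
    push_cast at hn
    omega

/-- `a 0, …, a n` is a geodesic starting at `v₀`. -/
def IsGeodesicUpTo (G : SimpleGraph V) (v₀ : V) (a : ℕ → V) (n : ℕ) : Prop :=
  (∀ i < n, G.Adj (a i) (a (i + 1))) ∧ ∀ i ≤ n, G.dist v₀ (a i) = i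

theorem IsGeodesicUpTo.mono {a : ℕ → V} {m n : ℕ} (h : IsGeodesicUpTo G v₀ a n) (hmn : m ≤ n) :
    IsGeodesicUpTo G v₀ a m :=
  ⟨fun i hi => h.1 i (by omega), fun i hi => h.2 i (by omega)⟩

theorem IsGeodesicUpTo.zero_eq (hG : G.Connected) {a : ℕ → V} {n : ℕ}
    (h : IsGeodesicUpTo G v₀ a n) : a 0 = v₀ :=
  (hG.dist_eq_zero_iff.1 (h.2 0 (Nat.zero_le n))).symm

theorem Boundary.isGeodesicUpTo (ω : Boundary G v₀) (n : ℕ) : IsGeodesicUpTo G v₀ ω.1 n :=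
  ⟨fun i _ => ω.2.2.1 i, fun i _ => ω.2.2.2 i⟩

theorem IsGeodesicUpTo.eq_of_eq (hG : G.IsTree) {a b : ℕ → V} {n : ℕ}
    (ha : IsGeodesicUpTo G v₀ a n) (hb : IsGeodesicUpTo G v₀ b n) (h : a n = b n) :
    ∀ i ≤ n, a i = b i := by
  induction n with
  | zero =>
    intro i hi
    obtain rfl : i = 0 := by omega
    exact h
  | succ n ih =>
    have : a n = b n := by
      refine eq_of_adj_of_dist_eq hG (v := v₀) (ha.1 n (by omega)).symm
        (h ▸ (hb.1 n (by omega)).symm) ?_ ?_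
      · rw [G.dist_comm, ha.2 (n + 1) le_rfl, G.dist_comm, ha.2 n (by omega)]
      · rw [G.dist_comm, ha.2 (n + 1) le_rfl, G.dist_comm, hb.2 n (by omega)]
    intro i hi
    rcases Nat.lt_or_ge i (n + 1) with h1 | h1
    · exact ih (ha.mono (by omega)) (hb.mono (by omega)) this i (by omega)
    · obtain rfl : i = n + 1 := by omega
      exact h

/-- A step of a geodesic starting at `v₀` points to `ω` only while the geodesic follows the ray
to `ω`. -/
theorem IsGeodesicUpTo.isToward_iff (hG : G.IsTree) {a : ℕ → V} {n : ℕ} {ω : Boundary G v₀}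
    (ha : IsGeodesicUpTo G v₀ a (n + 1)) :
    IsToward G ω (a n) (a (n + 1)) ↔ ∀ i ≤ n + 1, ω.1 i = a i := by
  constructor
  · intro h
    have hadj := ha.1 n (by omega)
    have h1 : G.dist (a (n + 1)) v₀ = G.dist (a n) v₀ + 1 := by
      rw [G.dist_comm, ha.2 (n + 1) le_rfl, G.dist_comm, ha.2 n (by omega)]
    obtain ⟨k, hk, hnk⟩ := (h.2.and (eventually_ge_atTop (n + 1))).exists
    have e := dist_eq_add_of_step hG (v := v₀) _ hadj h1 hk rfl
    have hω := ω.2.2.2 k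
    have hn := ha.2 n (by omega)
    have hn1 := ha.2 (n + 1) le_rfl
    rw [G.dist_comm] at e
    rw [G.dist_comm (u := a n) (v := v₀)] at e
    obtain ⟨l, rfl⟩ := Nat.exists_eq_add_of_le hnk
    have hl := ω.dist_le hG.connected (n + 1) l
    have hωn := ω.2.2.2 (n + 1)
    refine (ω.isGeodesicUpTo (n + 1)).eq_of_eq hG ha ?_
    exact eq_of_between hG (v := v₀) (z := ω.1 (n + 1 + l)) _ rfl (by omega) (by omega) (by omega)
  · intro h
    rw [← h n (by omega), ← h (n + 1) le_rfl]
    exact isToward_ray hG.connected ω n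

theorem exists_isGeodesicUpTo (hG : G.Connected) (x : V) :
    ∃ a, IsGeodesicUpTo G v₀ a (G.dist v₀ x) ∧ a (G.dist v₀ x) = x := by
  obtain ⟨p, hp⟩ := hG.exists_walk_length_eq_dist v₀ x
  refine ⟨p.getVert, ⟨fun i hi => p.adj_getVert_succ (by omega), ?_⟩, by
    rw [← hp, SimpleGraph.Walk.getVert_length]⟩
  intro i hi
  have h1 := (SimpleGraph.dist_le (p.take i))
  have h2 := (SimpleGraph.dist_le (p.drop i))
  have h3 := hG.dist_triangle (u := v₀) (v := p.getVert i) (w := x)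
  simp only [SimpleGraph.Walk.take_length, SimpleGraph.Walk.drop_length] at h1 h2
  omega

end Geometry

/-! ### Cylinders and Markov chains on trajectories -/

section Trajectories

theorem countable_of_connected {G : SimpleGraph V} [G.LocallyFinite] (hG : G.Connected) (v₀ : V) :
    Countable V := by
  have hfin : ∀ n, {x | G.dist v₀ x ≤ n}.Finite := by
    intro n
    induction n with
    | zero =>
      refine (Set.finite_singleton v₀).subset fun x hx => ?_
      exact (hG.dist_eq_zero_iff.1 (Nat.le_zero.1 hx)).symm
    | succ n ih =>
      refine (ih.union (ih.biUnion fun y _ => (G.neighborFinset y).finite_toSet)).subset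
        fun x hx => ?_
      rcases Nat.lt_or_ge (G.dist v₀ x) (n + 1) with h | h
      · exact Or.inl (Nat.lt_succ_iff.1 h)
      · have hx' : G.dist x v₀ = n + 1 := by
          rw [G.dist_comm]
          exact le_antisymm hx h
        obtain ⟨y, hy, hd⟩ := exists_adj_dist hG hx'
        rw [G.dist_comm] at hd
        exact Or.inr (Set.mem_biUnion (show y ∈ {x | G.dist v₀ x ≤ n} from hd.le)
          (by simpa using hy.symm))
  have : (Set.univ : Set V) = ⋃ n, {x | G.dist v₀ x ≤ n} :=
    (Set.eq_univ_of_forall fun x => Set.mem_iUnion.2 ⟨G.dist v₀ x, le_refl (G.dist v₀ x)⟩).symm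
  rw [← Set.countable_univ_iff, this]
  exact Set.countable_iUnion fun n => (hfin n).countable

/-- The sequences which agree with `a` up to time `n`. -/
def initialCylinder (a : ℕ → V) (n : ℕ) : Set (ℕ → V) := {w | ∀ i ≤ n, w i = a i}

theorem cylinder_eq {G : SimpleGraph V} {v₀ x : V} (p : G.Walk v₀ x) :
    cylinder p = initialCylinder p.getVert p.length := rfl

theorem initialCylinder_succ (a : ℕ → V) (n : ℕ) :
    initialCylinder a (n + 1) = initialCylinder a n ∩ {w | w (n + 1) = a (n + 1)} := by
  ext w
  constructor
  · exact fun h => ⟨fun i hi => h i (by omega), h (n + 1) le_rfl⟩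
  · rintro ⟨h1, h2⟩ i hi
    rcases Nat.lt_or_ge i (n + 1) with h | h
    · exact h1 i (by omega)
    · obtain rfl : i = n + 1 := by omega
      exact h2

theorem initialCylinder_congr {a b : ℕ → V} {n : ℕ} (h : ∀ i ≤ n, a i = b i) :
    initialCylinder a n = initialCylinder b n := by
  ext w
  exact forall₂_congr fun i hi => by rw [h i hi]

/-- The initial cylinders, together with the empty set. -/
def initialCylinders (V : Type*) : Set (Set (ℕ → V)) :=
  insert ∅ {s | ∃ a n, s = initialCylinder a n}

theorem isPiSystem_initialCylinders : IsPiSystem (initialCylinders V) := by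
  have key : ∀ (a b : ℕ → V) {m n : ℕ}, m ≤ n →
      (initialCylinder a m ∩ initialCylinder b n).Nonempty →
      initialCylinder a m ∩ initialCylinder b n = initialCylinder b n := by
    rintro a b m n hmn ⟨w, h1, h2⟩
    refine Set.inter_eq_right.2 fun v hv i hi => ?_
    rw [hv i (hi.trans hmn), ← h1 i hi, h2 i (hi.trans hmn)]
  rintro s hs t ht hst
  rcases hs with rfl | ⟨a, m, rfl⟩
  · simp at hst
  rcases ht with rfl | ⟨b, n, rfl⟩
  · simp at hst
  rcases le_total m n with h | h
  · rw [key a b h hst]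
    exact Or.inr ⟨b, n, rfl⟩
  · rw [Set.inter_comm] at hst ⊢
    rw [key b a h hst]
    exact Or.inr ⟨a, m, rfl⟩

variable [MeasurableSpace V] [DiscreteMeasurableSpace V]

theorem measurableSet_coord (P : V → Prop) (n : ℕ) : MeasurableSet {w : ℕ → V | P (w n)} :=
  measurable_pi_apply n (MeasurableSet.of_discrete (s := {x | P x}))

theorem measurableSet_coord₂ [Countable V] (P : V → V → Prop) (m n : ℕ) :
    MeasurableSet {w : ℕ → V | P (w m) (w n)} := by
  have h : Measurable fun w : ℕ → V => (w m, w n) := by fun_prop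
  exact h (MeasurableSet.of_discrete (s := {x : V × V | P x.1 x.2}))

theorem measurableSet_initialCylinder (a : ℕ → V) (n : ℕ) :
    MeasurableSet (initialCylinder a n) := by
  have : initialCylinder a n = ⋂ i, ⋂ (_ : i ≤ n), {w | w i = a i} := by
    ext w; simp [initialCylinder]
  rw [this]
  exact MeasurableSet.iInter fun i => MeasurableSet.iInter fun _ =>
    measurableSet_coord (fun x => x = a i) i

theorem generateFrom_initialCylinders [Countable V] :
    (inferInstance : MeasurableSpace (ℕ → V)) =
      MeasurableSpace.generateFrom (initialCylinders V) := by
  apply le_antisymm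
  · refine iSup_le fun n => ?_
    rintro _ ⟨s, -, rfl⟩
    -- an event on the `n`-th coordinate is a countable union of cylinders
    have : (fun w : ℕ → V => w n) ⁻¹' s =
        ⋃ b : {b : Fin (n + 1) → V // b (Fin.last n) ∈ s},
          initialCylinder (fun i => b.1 (Fin.ofNat (n + 1) i)) n := by
      ext w
      simp only [Set.mem_preimage, Set.mem_iUnion, initialCylinder, Set.mem_ofPred_eq]
      constructor
      · intro h
        refine ⟨⟨fun i => w i, by simpa using h⟩, fun i hi => ?_⟩
        simp [Nat.mod_eq_of_lt (Nat.lt_succ_of_le hi)]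
      · rintro ⟨b, hb⟩
        rw [hb n le_rfl]
        convert b.2
        ext
        simp
    rw [this]
    exact MeasurableSet.iUnion fun b =>
      MeasurableSpace.measurableSet_generateFrom (Or.inr ⟨_, _, rfl⟩)
  · refine MeasurableSpace.generateFrom_le ?_
    rintro s (rfl | ⟨a, n, rfl⟩)
    · exact MeasurableSet.empty
    · exact measurableSet_initialCylinder a n

theorem measure_ext_initialCylinder [Countable V] {μ ν : Measure (ℕ → V)} [IsProbabilityMeasure μ]
    [IsProbabilityMeasure ν] (h : ∀ a n, μ (initialCylinder a n) = ν (initialCylinder a n)) :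
    μ = ν := by
  refine ext_of_generate_finite _ generateFrom_initialCylinders isPiSystem_initialCylinders ?_
    (by simp)
  rintro s (rfl | ⟨a, n, rfl⟩)
  · simp
  · exact h a n

section Chain

variable (p : V → PMF V) (v₀ : V)

instance : IsProbabilityMeasure (chainLaw p v₀) := by
  unfold chainLaw
  infer_instance

/-- The Markov property. -/
theorem lintegral_chainLaw_succ [Countable V] (n : ℕ)
    {F : ((_i : Finset.Iic n) → V) × V → ENNReal} (hF : Measurable F) :
    ∫⁻ w, F (Preorder.frestrictLe n w, w (n + 1)) ∂(chainLaw p v₀) =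
      ∫⁻ w, ∫⁻ y, F (Preorder.frestrictLe n w, y) ∂(p (w n)).toMeasure ∂(chainLaw p v₀) := by
  have h := Kernel.map_frestrictLe_trajMeasure_compProd_eq_map_trajMeasure
    (X := fun _ => V) (μ₀ := Measure.dirac v₀) (κ := chainKernel p) (a := n)
  have h' := congrArg (fun μ => ∫⁻ x, F x ∂μ) h
  have hm : Measurable fun w : ℕ → V =>
      ((Preorder.frestrictLe n w, w (n + 1)) : ((_i : Finset.Iic n) → V) × V) :=
    (by fun_prop : Measurable (Preorder.frestrictLe (π := fun _ => V) n)).prodMk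
      (measurable_pi_apply _)
  rw [lintegral_map hF hm, Measure.lintegral_compProd hF,
    lintegral_map hF.lintegral_kernel_prod_right' (by fun_prop)] at h'
  exact h'.symm

theorem lintegral_chainLaw_coord_succ [Countable V] (n : ℕ) (F : V → V → ENNReal) :
    ∫⁻ w, F (w n) (w (n + 1)) ∂(chainLaw p v₀) =
      ∫⁻ w, ∫⁻ y, F (w n) y ∂(p (w n)).toMeasure ∂(chainLaw p v₀) := by
  refine lintegral_chainLaw_succ p v₀ n
    (F := fun x => F (x.1 ⟨n, Finset.mem_Iic.2 le_rfl⟩) x.2) ?_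
  have h : Measurable fun x : ((_i : Finset.Iic n) → V) × V =>
      (x.1 ⟨n, Finset.mem_Iic.2 le_rfl⟩, x.2) := by fun_prop
  exact (Measurable.of_discrete (f := fun x : V × V => F x.1 x.2)).comp h

theorem chainLaw_start : ∀ᵐ w ∂(chainLaw p v₀), w 0 = v₀ := by
  have h : (chainLaw p v₀).map (Preorder.frestrictLe (π := fun _ => V) 0) =
      (Measure.dirac v₀).map
        (MeasurableEquiv.piUnique (fun _ : Finset.Iic 0 => V)).symm := by
    rw [chainLaw, Kernel.trajMeasure, Measure.map_comp _ _ (by fun_prop),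
      Kernel.traj_map_frestrictLe, Kernel.partialTraj_self]
    exact Measure.id_comp
  have hd : (Measure.dirac v₀).map (MeasurableEquiv.piUnique (fun _ : Finset.Iic 0 => V)).symm =
      Measure.dirac ((MeasurableEquiv.piUnique (fun _ : Finset.Iic 0 => V)).symm v₀) :=
    Measure.map_dirac' (MeasurableEquiv.measurable _) _
  rw [hd] at h
  have hs : MeasurableSet {x : (_i : Finset.Iic 0) → V | x ⟨0, Finset.mem_Iic.2 le_rfl⟩ ≠ v₀} := by
    have h : Measurable fun x : (_i : Finset.Iic 0) → V => x ⟨0, Finset.mem_Iic.2 le_rfl⟩ :=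
      measurable_pi_apply _
    exact h (MeasurableSet.of_discrete (s := {x : V | x ≠ v₀}))
  have h' := congrArg (fun μ => μ {x | x ⟨0, Finset.mem_Iic.2 le_rfl⟩ ≠ v₀}) h
  rw [Measure.map_apply (by fun_prop) hs, Measure.dirac_apply' _ hs] at h'
  rw [ae_iff]
  refine Eq.trans h' ?_
  rw [Set.indicator_of_notMem]
  simp [MeasurableEquiv.piUnique]

theorem ae_chainLaw_step [Countable V] :
    ∀ᵐ w ∂(chainLaw p v₀), ∀ n, w (n + 1) ∈ (p (w n)).support := by
  rw [ae_all_iff]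
  intro n
  have h := lintegral_chainLaw_coord_succ p v₀ n
    (fun x y => Set.indicator {y | y ∉ (p x).support} (fun _ => 1) y)
  have hz : ∀ x, ∫⁻ y, Set.indicator {y | y ∉ (p x).support} (fun _ => (1 : ENNReal)) y
      ∂(p x).toMeasure = 0 := fun x => by
    rw [lintegral_indicator (MeasurableSet.of_discrete), setLIntegral_const, one_mul,
      PMF.toMeasure_apply_eq_zero_iff _ MeasurableSet.of_discrete]
    exact Set.disjoint_left.2 fun y h1 h2 => h2 h1
  simp only [hz, lintegral_zero] at h
  rw [lintegral_eq_zero_iff] at h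
  · filter_upwards [h] with w hw
    by_contra hn
    rw [Set.indicator_of_mem (show w (n + 1) ∈ {y | y ∉ (p (w n)).support} from hn)] at hw
    exact one_ne_zero hw
  · have hm : Measurable fun w : ℕ → V => (w n, w (n + 1)) := by fun_prop
    exact (Measurable.of_discrete (f := fun x : V × V =>
      Set.indicator {y | y ∉ (p x.1).support} (fun _ => (1 : ENNReal)) x.2)).comp hm

theorem chainLaw_initialCylinder_zero [DecidableEq V] (a : ℕ → V) :
    chainLaw p v₀ (initialCylinder a 0) = if a 0 = v₀ then 1 else 0 := by
  have h := chainLaw_start p v₀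
  split_ifs with h0
  · rw [prob_compl_eq_zero_iff (measurableSet_initialCylinder a 0) |>.symm]
    refine measure_mono_null (fun w hw => ?_) h
    intro (hw0 : w 0 = v₀)
    exact hw fun i hi => by rw [Nat.le_zero.1 hi, hw0, h0]
  · refine measure_mono_null (fun w hw => ?_) h
    intro (hw0 : w 0 = v₀)
    exact h0 (by rw [← hw 0 le_rfl, hw0])

theorem chainLaw_initialCylinder_succ [Countable V] (a : ℕ → V) (n : ℕ) :
    chainLaw p v₀ (initialCylinder a (n + 1)) =
      chainLaw p v₀ (initialCylinder a n) * p (a n) (a (n + 1)) := by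
  have hS : MeasurableSet {x : (_i : Finset.Iic n) → V | ∀ i : Finset.Iic n, x i = a i} := by
    have : {x : (_i : Finset.Iic n) → V | ∀ i : Finset.Iic n, x i = a i} =
        ⋂ i : Finset.Iic n, (fun x => x i) ⁻¹' {y | y = a i} := by
      ext; simp
    rw [this]
    exact MeasurableSet.iInter fun i => measurable_pi_apply i MeasurableSet.of_discrete
  have hT : MeasurableSet {y : V | y = a (n + 1)} := MeasurableSet.of_discrete
  have h := lintegral_chainLaw_succ p v₀ n
    (F := Set.indicator ({x : (_i : Finset.Iic n) → V | ∀ i : Finset.Iic n, x i = a i} ×ˢ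
      {y | y = a (n + 1)}) fun _ => 1)
    (measurable_const.indicator (hS.prod hT))
  have h1 : ∀ w : ℕ → V, Set.indicator
      ({x : (_i : Finset.Iic n) → V | ∀ i : Finset.Iic n, x i = a i} ×ˢ {y | y = a (n + 1)})
      (fun _ => (1 : ENNReal)) (Preorder.frestrictLe n w, w (n + 1)) =
      (initialCylinder a (n + 1)).indicator (fun _ => 1) w := fun w => by
    refine Set.indicator_const_eq_indicator_const ?_
    rw [initialCylinder_succ]
    simp [initialCylinder, Preorder.frestrictLe]
  have h2 : ∀ w : ℕ → V, ∫⁻ y, Set.indicator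
      ({x : (_i : Finset.Iic n) → V | ∀ i : Finset.Iic n, x i = a i} ×ˢ {y | y = a (n + 1)})
      (fun _ => (1 : ENNReal)) (Preorder.frestrictLe n w, y) ∂(p (w n)).toMeasure =
      (initialCylinder a n).indicator (fun _ => p (a n) (a (n + 1))) w := fun w => by
    by_cases hw : w ∈ initialCylinder a n
    · rw [Set.indicator_of_mem hw, hw n le_rfl,
        ← PMF.toMeasure_apply_singleton (p (a n)) (a (n + 1)) MeasurableSet.of_discrete,
        ← lintegral_indicator_one MeasurableSet.of_discrete]
      refine lintegral_congr fun y => ?_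
      refine Set.indicator_const_eq_indicator_const ?_
      have : ∀ i, i ≤ n → w i = a i := hw
      simpa [Preorder.frestrictLe] using fun _ => this
    · rw [Set.indicator_of_notMem hw, lintegral_eq_zero_of_ae_eq_zero]
      refine Eventually.of_forall fun y => Set.indicator_of_notMem (fun hy => hw ?_) _
      intro i hi
      exact hy.1 ⟨i, Finset.mem_Iic.2 hi⟩
  simp only [h1, h2] at h
  rw [lintegral_indicator (measurableSet_initialCylinder a _),
    lintegral_indicator (measurableSet_initialCylinder a _), setLIntegral_const,
    setLIntegral_const, one_mul, mul_comm] at h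
  rw [h, mul_comm]

end Chain
end Trajectories

/-! ### Biased walks -/

section BiasedWalk

variable {G : SimpleGraph V} {v₀ : V} {q : ℕ}

theorem stepProb_toward {ω : Boundary G v₀} (r : unitInterval) {x y : V} (h : IsToward G ω x y) :
    stepProb G q ω r x y = ENNReal.ofReal r := by
  rw [stepProb, if_pos h.1, if_pos h]

theorem stepProb_away {ω : Boundary G v₀} (r : unitInterval) {x y : V} (ha : G.Adj x y)
    (h : ¬ IsToward G ω x y) : stepProb G q ω r x y = ENNReal.ofReal ((1 - r) / q) := by
  rw [stepProb, if_pos ha, if_neg h]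

theorem measurable_ray [MeasurableSpace V] (n : ℕ) : Measurable fun ω : Boundary G v₀ => ω.1 n :=
  (measurable_pi_apply n).comp measurable_subtype_coe

variable [G.LocallyFinite] (hq : 2 ≤ q) [hG : IsHomogeneousTree G q]

include hG in
theorem countable_vertices (v₀ : V) : Countable V :=
  countable_of_connected hG.isTree.connected v₀

theorem stepLaw_apply (ω : Boundary G v₀) (r : unitInterval) (x y : V) :
    stepLaw G hq ω r x y = stepProb G q ω r x y := rfl

variable [MeasurableSpace V] [DiscreteMeasurableSpace V]

instance (ω : Boundary G v₀) (r : unitInterval) : IsProbabilityMeasure (lam G hq ω r) := by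
  unfold lam
  infer_instance

theorem lam_initialCylinder_zero (ω : Boundary G v₀) (r : unitInterval) {a : ℕ → V}
    (ha : a 0 = v₀) : lam G hq ω r (initialCylinder a 0) = 1 := by
  classical
  rw [lam, chainLaw_initialCylinder_zero, if_pos ha]

theorem lam_initialCylinder_succ (ω : Boundary G v₀) (r : unitInterval) (a : ℕ → V) (n : ℕ) :
    lam G hq ω r (initialCylinder a (n + 1)) =
      lam G hq ω r (initialCylinder a n) * stepProb G q ω r (a n) (a (n + 1)) := by
  have := countable_vertices (G := G) (q := q) v₀
  rw [lam, chainLaw_initialCylinder_succ, stepLaw_apply]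

theorem lam_initialCylinder_eq_zero (ω : Boundary G v₀) (r : unitInterval) {a : ℕ → V} {n : ℕ}
    (h : ¬ (a 0 = v₀ ∧ ∀ i < n, G.Adj (a i) (a (i + 1)))) :
    lam G hq ω r (initialCylinder a n) = 0 := by
  classical
  induction n with
  | zero =>
    rw [lam, chainLaw_initialCylinder_zero, if_neg fun h0 => h ⟨h0, by simp⟩]
  | succ n ih =>
    rw [lam_initialCylinder_succ]
    by_cases hn : G.Adj (a n) (a (n + 1))
    · rw [ih fun hh => h ⟨hh.1, fun i hi => ?_⟩, zero_mul]
      rcases Nat.lt_or_ge i n with h1 | h1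
      · exact hh.2 i h1
      · obtain rfl : i = n := by omega
        exact hn
    · rw [stepProb, if_neg hn, mul_zero]

/-- The probability of a finite path depends only on its numbers `u` and `d` of steps towards `ω`
and away from it, and these are determined by the length and the end point of the path. -/
theorem lam_initialCylinder_eq (ω : Boundary G v₀) {a : ℕ → V} (h0 : a 0 = v₀) :
    ∀ n, (∀ i < n, G.Adj (a i) (a (i + 1))) → ∃ u d : ℕ, u + d = n ∧
      (d : ℤ) - u = busemann hG.isTree ω (a n) ∧ ∀ r : unitInterval,
        lam G hq ω r (initialCylinder a n) =
          ENNReal.ofReal r ^ u * ENNReal.ofReal ((1 - r) / q) ^ d := by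
  intro n
  induction n with
  | zero =>
    intro _
    refine ⟨0, 0, rfl, by simp [h0, busemann_base], fun r => ?_⟩
    simp [lam_initialCylinder_zero hq ω r h0]
  | succ n ih =>
    intro h
    obtain ⟨u, d, hud, hb, hlam⟩ := ih fun i hi => h i (by omega)
    have hadj := h n (by omega)
    by_cases ht : IsToward G ω (a n) (a (n + 1))
    · refine ⟨u + 1, d, by omega, ?_, fun r => ?_⟩
      · rw [busemann_of_isToward hG.isTree ht, ← hb]
        push_cast
        ring
      · rw [lam_initialCylinder_succ, hlam, stepProb_toward r ht]
        ring
    · refine ⟨u, d + 1, by omega, ?_, fun r => ?_⟩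
      · rw [busemann_of_not_isToward hG.isTree hadj ht, ← hb]
        push_cast
        ring
      · rw [lam_initialCylinder_succ, hlam, stepProb_away r hadj ht]
        ring

/-- The probability of a finite path is that of the geodesic to its end point times a factor
which does not depend on `ω`. -/
theorem exists_geodesic_lam_eq {a : ℕ → V} (h0 : a 0 = v₀) {n : ℕ}
    (h : ∀ i < n, G.Adj (a i) (a (i + 1))) :
    ∃ (b : ℕ → V) (l m : ℕ), IsGeodesicUpTo G v₀ b l ∧ ∀ (ω : Boundary G v₀) (r : unitInterval),
      lam G hq ω r (initialCylinder a n) = lam G hq ω r (initialCylinder b l) *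
        (ENNReal.ofReal r * ENNReal.ofReal ((1 - r) / q)) ^ m := by
  obtain ⟨b, hb, hba⟩ := exists_isGeodesicUpTo (v₀ := v₀) hG.isTree.connected (a n)
  have hln : G.dist v₀ (a n) ≤ n := by
    have : ∀ i ≤ n, G.dist v₀ (a i) ≤ i := by
      intro i
      induction i with
      | zero => simp [h0]
      | succ i ih =>
        intro hi
        have h1 := ih (by omega)
        have h2 := dist_adj_le hG.isTree.connected (x := v₀) (h i (by omega))
        omega
    exact this n le_rfl
  refine ⟨b, G.dist v₀ (a n), (n - G.dist v₀ (a n)) / 2, hb, fun ω r => ?_⟩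
  obtain ⟨u, d, hud, hbu, hlam⟩ := lam_initialCylinder_eq hq ω h0 n h
  obtain ⟨u', d', hud', hbu', hlam'⟩ := lam_initialCylinder_eq hq ω
    (hb.zero_eq hG.isTree.connected) _ hb.1
  rw [hba] at hbu'
  rw [hlam, hlam']
  set m := (n - G.dist v₀ (a n)) / 2 with hm
  obtain rfl : u = u' + m := by omega
  obtain rfl : d = d' + m := by omega
  ring

theorem mem_pathSpace_ae (ω : Boundary G v₀) (r : unitInterval) :
    ∀ᵐ w ∂(lam G hq ω r), w ∈ pathSpace G v₀ := by
  have := countable_vertices (G := G) (q := q) v₀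
  unfold lam
  filter_upwards [chainLaw_start (stepLaw G hq ω r) v₀, ae_chainLaw_step (stepLaw G hq ω r) v₀]
    with w h0 hw
  refine ⟨h0, fun n => ?_⟩
  by_contra hn
  exact (PMF.mem_support_iff _ _).1 (hw n) (by rw [stepLaw_apply, stepProb, if_neg hn])

theorem isCentral_lam (ω : Boundary G v₀) (r : unitInterval) :
    IsCentral G v₀ (lam G hq ω r) where
  isProbabilityMeasure := inferInstance
  ae_mem := mem_pathSpace_ae hq ω r
  uniform x p p' hp := by
    rw [cylinder_eq, cylinder_eq]
    obtain ⟨u, d, hud, hb, hlam⟩ := lam_initialCylinder_eq hq ω p.getVert_zero p.length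
      fun i hi => p.adj_getVert_succ hi
    obtain ⟨u', d', hud', hb', hlam'⟩ := lam_initialCylinder_eq hq ω p'.getVert_zero p'.length
      fun i hi => p'.adj_getVert_succ hi
    rw [SimpleGraph.Walk.getVert_length] at hb hb'
    obtain rfl : u = u' := by omega
    obtain rfl : d = d' := by omega
    rw [hlam, hlam']

omit [G.LocallyFinite] in
theorem measurableSet_isToward (x y : V) :
    MeasurableSet {ω : Boundary G v₀ | IsToward G ω x y} := by
  by_cases h : G.Adj x y
  · have : {ω : Boundary G v₀ | IsToward G ω x y} =
        ⋃ N, ⋂ n, ⋂ (_ : N ≤ n), {ω | G.dist x (ω.1 n) = G.dist y (ω.1 n) + 1} := by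
      ext ω
      simp [IsToward, h, eventually_atTop]
    rw [this]
    exact MeasurableSet.iUnion fun N => MeasurableSet.iInter fun n => MeasurableSet.iInter fun _ =>
      measurable_ray n (MeasurableSet.of_discrete (s := {z | G.dist x z = G.dist y z + 1}))
  · have : {ω : Boundary G v₀ | IsToward G ω x y} = ∅ := by
      ext ω
      simp [IsToward, h]
    rw [this]
    exact MeasurableSet.empty

omit [G.LocallyFinite] hG in
theorem measurable_stepProb (r : unitInterval) (x y : V) :
    Measurable fun ω : Boundary G v₀ => stepProb G q ω r x y := by
  unfold stepProb
  by_cases h : G.Adj x y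
  · simp only [h, if_true]
    exact Measurable.ite (measurableSet_isToward x y) measurable_const measurable_const
  · simp only [h, if_false]
    exact measurable_const

theorem measurable_lam_initialCylinder (r : unitInterval) (a : ℕ → V) (n : ℕ) :
    Measurable fun ω : Boundary G v₀ => lam G hq ω r (initialCylinder a n) := by
  induction n with
  | zero =>
    by_cases h : a 0 = v₀
    · simp only [lam_initialCylinder_zero hq _ r h]
      exact measurable_const
    · simp only [lam_initialCylinder_eq_zero hq _ r fun h' : _ ∧ ∀ i < 0, _ => h h'.1]
      exact measurable_const
  | succ n ih =>
    simp only [lam_initialCylinder_succ]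
    exact ih.mul (measurable_stepProb r _ _)

theorem measurable_lam (r : unitInterval) :
    Measurable fun ω : Boundary G v₀ => lam G hq ω r := by
  have := countable_vertices (G := G) (q := q) v₀
  refine Measurable.measure_of_isPiSystem_of_isProbabilityMeasure
    generateFrom_initialCylinders isPiSystem_initialCylinders ?_
  rintro s (rfl | ⟨a, n, rfl⟩)
  · simp
  · exact measurable_lam_initialCylinder hq r a n

/-- A measure on the space of ends decomposes `λ_{ω₀,r}` as soon as it does so on the finite
geodesics starting at `v₀`. -/
theorem isDecomposition_of_geodesic (ω₀ : Boundary G v₀) (r : unitInterval)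
    (ρ : Measure (Boundary G v₀)) [IsProbabilityMeasure ρ]
    (h : ∀ a n, IsGeodesicUpTo G v₀ a n → lam G hq ω₀ r (initialCylinder a n) =
      ∫⁻ ω, lam G hq ω (unitInterval.symm r) (initialCylinder a n) ∂ρ) :
    IsDecomposition G hq ω₀ r ρ where
  isProbabilityMeasure := inferInstance
  eq_lintegral := by
    have := countable_vertices (G := G) (q := q) v₀
    have hm := measurable_lam (G := G) hq (v₀ := v₀) (unitInterval.symm r)
    suffices hs : lam G hq ω₀ r = ρ.bind fun ω => lam G hq ω (unitInterval.symm r) by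
      intro A hA
      rw [hs, Measure.bind_apply hA hm.aemeasurable]
    have : IsProbabilityMeasure (ρ.bind fun ω => lam G hq ω (unitInterval.symm r)) :=
      ⟨by rw [Measure.bind_apply MeasurableSet.univ hm.aemeasurable]; simp⟩
    refine measure_ext_initialCylinder fun a n => ?_
    rw [Measure.bind_apply (measurableSet_initialCylinder a n) hm.aemeasurable]
    by_cases ha : a 0 = v₀ ∧ ∀ i < n, G.Adj (a i) (a (i + 1))
    · obtain ⟨b, l, m, hb, hlam⟩ := exists_geodesic_lam_eq (G := G) hq ha.1 ha.2
      simp only [hlam]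
      rw [lintegral_mul_const _ (measurable_lam_initialCylinder hq _ b l), h b l hb]
      -- the product of the two one-step probabilities is invariant under `r ↦ 1 - r`
      congr 2
      rw [← ENNReal.ofReal_mul r.2.1, ← ENNReal.ofReal_mul (unitInterval.symm r).2.1]
      congr 1
      rw [unitInterval.coe_symm_eq]
      ring
    · simp [lam_initialCylinder_eq_zero hq _ _ ha]

end BiasedWalk

/-! ### Convergence to ends -/

section Limit

variable {G : SimpleGraph V} {v₀ : V}

theorem ConvergesTo.unique (hG : G.IsTree) {w : ℕ → V} {ω ω' : Boundary G v₀}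
    (h : ConvergesTo w ω) (h' : ConvergesTo w ω') : ω = ω' := by
  refine Subtype.ext (funext fun m => ?_)
  obtain ⟨i, h1, h2⟩ := ((h m).and (h' m)).exists
  exact eq_of_between hG _ rfl h1 h2 (by rw [ω.2.2.2, ω'.2.2.2])

/-- Convergence to some end is expressed by countably many conditions on the trajectory. -/
theorem exists_convergesTo_iff (hG : G.IsTree) {w : ℕ → V} :
    (∃ ω : Boundary G v₀, ConvergesTo w ω) ↔ ∀ m : ℕ, ∃ x, G.dist v₀ x = m ∧
      ∀ᶠ i in atTop, G.dist v₀ x + G.dist x (w i) = G.dist v₀ (w i) := by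
  constructor
  · rintro ⟨ω, hω⟩ m
    exact ⟨ω.1 m, ω.2.2.2 m, hω m⟩
  · intro h
    choose x hx hxw using h
    refine ⟨⟨x, (hG.connected.dist_eq_zero_iff.1 (hx 0)).symm, fun m => ?_, hx⟩, hxw⟩
    obtain ⟨y, hy, hd⟩ := exists_adj_dist hG.connected
      (show G.dist (x (m + 1)) v₀ = m + 1 by rw [G.dist_comm, hx])
    rw [G.dist_comm] at hd
    obtain ⟨i, h1, h2⟩ := ((hxw m).and (hxw (m + 1))).exists
    have h3 := hG.connected.dist_triangle (u := v₀) (v := y) (w := w i)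
    have h4 := hG.connected.dist_triangle (u := y) (v := x (m + 1)) (w := w i)
    have h5 : G.dist y (x (m + 1)) = 1 := SimpleGraph.dist_eq_one_iff_adj.2 hy.symm
    have hx0 := hx m
    have hx1 := hx (m + 1)
    have : x m = y := eq_of_between hG _ rfl h1 (by omega) (by omega)
    rw [this]
    exact hy.symm

theorem convergesTo_of_busemann (hG : G.IsTree) {ω : Boundary G v₀} {w : ℕ → V}
    (h : ∀ m : ℕ, ∀ᶠ i in atTop, busemann hG ω (w i) < -m) : ConvergesTo w ω :=
  fun m => (h m).mono fun _ hi => between_of_busemann_lt hG hi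

/-- The limit of a trajectory which converges to an end. -/
noncomputable def limitEnd (G : SimpleGraph V) (v₀ : V)
    (w : {w : ℕ → V // ∃ ω : Boundary G v₀, ConvergesTo w ω}) : Boundary G v₀ := w.2.choose

theorem limitEnd_eq (hG : G.IsTree) {w : {w : ℕ → V // ∃ ω : Boundary G v₀, ConvergesTo w ω}}
    {ω : Boundary G v₀} (h : ConvergesTo w.1 ω) : limitEnd G v₀ w = ω :=
  ConvergesTo.unique hG w.2.choose_spec h

/-- The trajectories which converge to an end in `B`. -/
def convergentTo (B : Set (Boundary G v₀)) : Set (ℕ → V) :=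
  (Subtype.val : {w : ℕ → V // ∃ ω : Boundary G v₀, ConvergesTo w ω} → ℕ → V) ''
    (limitEnd G v₀ ⁻¹' B)

variable [MeasurableSpace V] [DiscreteMeasurableSpace V]

theorem measurableSet_eventually_between (v₀ x : V) : MeasurableSet {w : ℕ → V | ∀ᶠ i in atTop,
    G.dist v₀ x + G.dist x (w i) = G.dist v₀ (w i)} := by
  have : {w : ℕ → V | ∀ᶠ i in atTop, G.dist v₀ x + G.dist x (w i) = G.dist v₀ (w i)} =
      ⋃ N, ⋂ i, ⋂ (_ : N ≤ i), {w | G.dist v₀ x + G.dist x (w i) = G.dist v₀ (w i)} := by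
    ext w
    simp [eventually_atTop]
  rw [this]
  exact MeasurableSet.iUnion fun N => MeasurableSet.iInter fun i => MeasurableSet.iInter fun _ =>
    measurableSet_coord (fun z => G.dist v₀ x + G.dist x z = G.dist v₀ z) i

theorem measurableSet_convergent [Countable V] (hG : G.IsTree) :
    MeasurableSet {w : ℕ → V | ∃ ω : Boundary G v₀, ConvergesTo w ω} := by
  have : {w : ℕ → V | ∃ ω : Boundary G v₀, ConvergesTo w ω} =
      ⋂ m : ℕ, ⋃ x : {x // G.dist v₀ x = m}, {w : ℕ → V | ∀ᶠ i in atTop,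
        G.dist v₀ x + G.dist x.1 (w i) = G.dist v₀ (w i)} := by
    ext w
    rw [Set.mem_iInter]
    refine (exists_convergesTo_iff hG).trans (forall_congr' fun m => ?_)
    simp
  rw [this]
  exact MeasurableSet.iInter fun m => MeasurableSet.iUnion fun x =>
    measurableSet_eventually_between v₀ x.1

theorem measurable_limitEnd [Countable V] (hG : G.IsTree) : Measurable (limitEnd G v₀) := by
  refine Measurable.subtype_mk (f := fun w => (limitEnd G v₀ w).1) ?_
  refine measurable_pi_lambda _ fun n => measurable_to_countable' fun x => ?_
  have hE := measurable_subtype_coe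
    (p := fun w : ℕ → V => ∃ ω : Boundary G v₀, ConvergesTo w ω)
    (measurableSet_eventually_between (G := G) v₀ x)
  by_cases hx : G.dist v₀ x = n
  · convert hE using 1
    ext w
    have hw : ConvergesTo w.1 (limitEnd G v₀ w) := w.2.choose_spec
    constructor
    · rintro rfl
      exact hw n
    · intro (h : ∀ᶠ i in atTop, G.dist v₀ x + G.dist x (w.1 i) = G.dist v₀ (w.1 i))
      obtain ⟨i, h1, h2⟩ := ((hw n).and h).exists
      exact eq_of_between hG _ rfl h1 h2 (by rw [(limitEnd G v₀ w).2.2.2 n, hx])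
  · convert MeasurableSet.empty using 1
    refine Set.eq_empty_of_forall_notMem fun w hw => hx ?_
    rw [← show (limitEnd G v₀ w).1 n = x from hw]
    exact (limitEnd G v₀ w).2.2.2 n

theorem measurableSet_convergentTo [Countable V] (hG : G.IsTree) {B : Set (Boundary G v₀)}
    (hB : MeasurableSet B) : MeasurableSet (convergentTo B) :=
  (MeasurableEmbedding.subtype_coe (measurableSet_convergent hG)).measurableSet_image.2
    (measurable_limitEnd hG hB)

variable [G.LocallyFinite] {q : ℕ} (hq : 2 ≤ q) [hG : IsHomogeneousTree G q]

theorem harmonicMeasure_apply {B : Set (Boundary G v₀)} (hB : MeasurableSet B) :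
    harmonicMeasure G q v₀ B = chainLaw (simpleStepLaw G q) v₀ (convergentTo B) := by
  have := countable_vertices (G := G) (q := q) v₀
  have he := MeasurableEmbedding.subtype_coe (measurableSet_convergent (v₀ := v₀) hG.isTree)
  exact (Measure.map_apply (measurable_limitEnd hG.isTree) hB).trans (he.comap_apply _ _)

theorem lintegral_stepLaw (ω : Boundary G v₀) (r : unitInterval) (x : V) (f : ℤ → ENNReal) :
    ∫⁻ y, f (busemann hG.isTree ω y) ∂(stepLaw G hq ω r x).toMeasure =
      ENNReal.ofReal r * f (busemann hG.isTree ω x - 1) +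
        ENNReal.ofReal (1 - r) * f (busemann hG.isTree ω x + 1) := by
  classical
  have := countable_vertices (G := G) (q := q) v₀
  set z := towardStep hG.isTree.connected ω x
  have hz : IsToward G ω x z := isToward_towardStep _ ω x
  have hmem : z ∈ G.neighborFinset x := by simpa using hz.1
  rw [lintegral_countable']
  simp only [PMF.toMeasure_apply_singleton _ _ MeasurableSet.of_discrete, stepLaw_apply]
  rw [tsum_eq_sum (s := G.neighborFinset x) fun y hy => by
    rw [SimpleGraph.mem_neighborFinset] at hy
    rw [stepProb, if_neg hy, mul_zero]]
  rw [← Finset.add_sum_erase _ _ hmem, stepProb_toward r hz, busemann_of_isToward hG.isTree hz,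
    mul_comm (f _)]
  congr 1
  have h1 : ∀ y ∈ (G.neighborFinset x).erase z, f (busemann hG.isTree ω y) *
      stepProb G q ω r x y = ENNReal.ofReal ((1 - r) / q) * f (busemann hG.isTree ω x + 1) :=
    fun y hy => by
      rw [Finset.mem_erase, SimpleGraph.mem_neighborFinset] at hy
      have hn : ¬ IsToward G ω x y := fun h => hy.1 (isToward_unique hG.isTree h hz)
      rw [stepProb_away r hy.2 hn, busemann_of_not_isToward hG.isTree hy.2 hn, mul_comm]
  have hcard : ((G.neighborFinset x).erase z).card = q := by
    rw [Finset.card_erase_of_mem hmem, SimpleGraph.card_neighborFinset_eq_degree,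
      hG.regular x, Nat.add_sub_cancel]
  have hq' : (q : ℝ) ≠ 0 := Nat.cast_ne_zero.2 (by omega)
  rw [Finset.sum_congr rfl h1, Finset.sum_const, hcard, nsmul_eq_mul, ← mul_assoc,
    ← ENNReal.ofReal_natCast, ← ENNReal.ofReal_mul (by positivity), mul_div_cancel₀ _ hq']

/-- The exponential moments of the Busemann function along the walk. -/
theorem lintegral_zpow_busemann (ω : Boundary G v₀) (s : unitInterval) {t : ℝ} (ht : 0 < t)
    (n : ℕ) : ∫⁻ w, ENNReal.ofReal (t ^ busemann hG.isTree ω (w n)) ∂(lam G hq ω s) =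
      ENNReal.ofReal (s / t + (1 - s) * t) ^ n := by
  have := countable_vertices (G := G) (q := q) v₀
  have hs0 := s.2.1
  have hs1 := sub_nonneg.2 s.2.2
  induction n with
  | zero =>
    rw [pow_zero, ← measure_univ (μ := lam G hq ω s), ← lintegral_one]
    refine lintegral_congr_ae ?_
    filter_upwards [mem_pathSpace_ae hq ω s] with w hw
    rw [hw.1, busemann_base, zpow_zero, ENNReal.ofReal_one]
  | succ n ih =>
    have h := lintegral_chainLaw_coord_succ (stepLaw G hq ω s) v₀ n
      fun _ y => ENNReal.ofReal (t ^ busemann hG.isTree ω y)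
    rw [pow_succ, ← ih, lam, h, ← lintegral_mul_const]
    · refine lintegral_congr fun w => ?_
      rw [lintegral_stepLaw hq ω s (w n) fun k => ENNReal.ofReal (t ^ k),
        ← ENNReal.ofReal_mul hs0, ← ENNReal.ofReal_mul hs1,
        ← ENNReal.ofReal_add (by positivity) (by positivity),
        ← ENNReal.ofReal_mul (by positivity), zpow_sub_one₀ ht.ne', zpow_add_one₀ ht.ne']
      congr 1
      field_simp
    · exact (Measurable.of_discrete
        (f := fun x => ENNReal.ofReal (t ^ busemann hG.isTree ω x))).comp (measurable_pi_apply n)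

/-- The walk with drift towards `ω` converges to `ω`. -/
theorem ae_convergesTo (ω : Boundary G v₀) {s : unitInterval} (hs : 1 / 2 < (s : ℝ)) :
    ∀ᵐ w ∂(lam G hq ω s), ConvergesTo w ω := by
  have hs1 := sub_nonneg.2 s.2.2
  have hmeas : ∀ n, Measurable fun w : ℕ → V =>
      ENNReal.ofReal ((2 * s : ℝ) ^ busemann hG.isTree ω (w n)) := fun n =>
    (Measurable.of_discrete (f := fun x =>
      ENNReal.ofReal ((2 * s : ℝ) ^ busemann hG.isTree ω x))).comp (measurable_pi_apply n)
  -- with base `2 s` the exponential moments decay geometrically, as `1 / 2 + 2 s (1 - s) < 1`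
  have hc : ENNReal.ofReal (s / (2 * s) + (1 - s) * (2 * s)) < 1 := by
    rw [← ENNReal.ofReal_one, ENNReal.ofReal_lt_ofReal_iff one_pos]
    have : (s : ℝ) / (2 * s) = 1 / 2 := by
      field_simp
    rw [this]
    nlinarith
  have hsum : ∫⁻ w, ∑' n, ENNReal.ofReal ((2 * s : ℝ) ^ busemann hG.isTree ω (w n))
      ∂(lam G hq ω s) ≠ ⊤ := by
    rw [lintegral_tsum fun n => (hmeas n).aemeasurable]
    simp only [lintegral_zpow_busemann hq ω s (show (0 : ℝ) < 2 * s by linarith)]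
    rw [ENNReal.tsum_geometric]
    exact ENNReal.inv_ne_top.2 (tsub_pos_of_lt hc).ne'
  filter_upwards [ae_lt_top (Measurable.tsum hmeas) hsum] with w hw
  refine convergesTo_of_busemann hG.isTree fun m => ?_
  have hlim := ENNReal.tendsto_atTop_zero_of_tsum_ne_top hw.ne
  have hpos : 0 < ENNReal.ofReal ((2 * s : ℝ) ^ (-m : ℤ)) :=
    ENNReal.ofReal_pos.2 (zpow_pos (by linarith) _)
  filter_upwards [hlim.eventually_lt_const hpos] with i hi
  rw [ENNReal.ofReal_lt_ofReal_iff (zpow_pos (by linarith) _)] at hi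
  exact (zpow_lt_zpow_iff_right₀ (by linarith)).1 hi

/-- For `s > 1 / 2`, the limit end of the trajectory has law `δ_ω` under `λ_{ω,s}`. -/
theorem lam_convergentTo (ω : Boundary G v₀) {s : unitInterval} (hs : 1 / 2 < (s : ℝ))
    (B : Set (Boundary G v₀)) :
    lam G hq ω s (convergentTo B) = B.indicator 1 ω := by
  have h := ae_convergesTo hq ω hs
  by_cases hω : ω ∈ B
  · rw [Set.indicator_of_mem hω, Pi.one_apply, ← measure_univ (μ := lam G hq ω s)]
    refine measure_congr ?_
    filter_upwards [h] with w hw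
    refine eq_true ?_ |>.trans (eq_true (Set.mem_univ w)).symm
    exact ⟨⟨w, ω, hw⟩, by rwa [Set.mem_preimage, limitEnd_eq hG.isTree hw], rfl⟩
  · rw [Set.indicator_of_notMem hω]
    refine measure_mono_null ?_ h
    rintro _ ⟨w, hw, rfl⟩ hc
    rw [Set.mem_preimage, limitEnd_eq hG.isTree hc] at hw
    exact hω hw

/-- A decomposing measure is the law of the limit end of the decomposed walk. -/
theorem IsDecomposition.apply_eq {ω₀ : Boundary G v₀} {r : unitInterval} (hr : (r : ℝ) < 1 / 2)
    {ρ : Measure (Boundary G v₀)} (h : IsDecomposition G hq ω₀ r ρ) {B : Set (Boundary G v₀)}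
    (hB : MeasurableSet B) : ρ B = lam G hq ω₀ r (convergentTo B) := by
  have := countable_vertices (G := G) (q := q) v₀
  rw [h.eq_lintegral _ (measurableSet_convergentTo hG.isTree hB)]
  simp only [lam_convergentTo hq _ (show 1 / 2 < (unitInterval.symm r : ℝ) by
    rw [unitInterval.coe_symm_eq]; linarith)]
  exact (lintegral_indicator_one hB).symm

/-- The parameter `1 / (q + 1)`, for which the biased walk is the simple random walk. -/
noncomputable def simpleParameter (q : ℕ) : unitInterval :=
  ⟨1 / (q + 1), by positivity, by
    rw [div_le_one (by positivity)]
    linarith [(Nat.cast_nonneg q : (0 : ℝ) ≤ q)]⟩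

omit [MeasurableSpace V] [DiscreteMeasurableSpace V] in
theorem simpleStepLaw_eq (ω : Boundary G v₀) :
    simpleStepLaw G q = stepLaw G hq ω (simpleParameter q) := by
  classical
  funext x
  ext y
  have hq' : (q : ℝ) ≠ 0 := Nat.cast_ne_zero.2 (by omega)
  have h : ENNReal.ofReal (1 / ((q : ℝ) + 1)) = ((q + 1 : ℕ) : ENNReal)⁻¹ := by
    rw [one_div, ENNReal.ofReal_inv_of_pos (by positivity)]
    congr 1
    exact_mod_cast ENNReal.ofReal_natCast (q + 1)
  rw [stepLaw_apply, simpleStepLaw, PMF.uniformOfFinset_apply,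
    SimpleGraph.card_neighborFinset_eq_degree, hG.regular x, ← h]
  by_cases hxy : G.Adj x y
  · rw [if_pos (by simpa using hxy)]
    by_cases ht : IsToward G ω x y
    · rw [stepProb_toward _ ht]
      rfl
    · rw [stepProb_away _ hxy ht]
      congr 1
      simp only [simpleParameter]
      field_simp
      ring
  · rw [if_neg (by simpa using hxy), stepProb, if_neg hxy]

theorem IsDecomposition.eq_harmonicMeasure {ω₀ : Boundary G v₀} {ρ : Measure (Boundary G v₀)}
    (h : IsDecomposition G hq ω₀ (simpleParameter q) ρ) : ρ = harmonicMeasure G q v₀ := by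
  ext B hB
  have hq' : (2 : ℝ) ≤ q := by exact_mod_cast hq
  rw [harmonicMeasure_apply hB, simpleStepLaw_eq hq ω₀]
  refine h.apply_eq hq ?_ hB
  simp only [simpleParameter]
  rw [div_lt_div_iff₀ (by positivity) (by positivity)]
  linarith

end Limit

/-! ### The uniform measure on the ends and the decomposing measure -/

section Shadows

variable {G : SimpleGraph V} {v₀ : V}

/-- The ends whose rays start with `a 0, …, a n`. -/
def shadow (a : ℕ → V) (n : ℕ) : Set (Boundary G v₀) := {ω | ∀ i ≤ n, ω.1 i = a i}

theorem shadow_zero (ω : Boundary G v₀) : (shadow ω.1 0 : Set (Boundary G v₀)) = Set.univ :=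
  Set.eq_univ_of_forall fun ω' i hi => by rw [Nat.le_zero.1 hi, ω.2.1, ω'.2.1]

theorem commonLength_eq {ω₀ ω : Boundary G v₀} {k : ℕ} (h : ∀ i ≤ k, ω.1 i = ω₀.1 i)
    (hk : ω.1 (k + 1) ≠ ω₀.1 (k + 1)) : commonLength ω₀ ω = k := by
  have : {n | ∀ i ≤ n, ω₀.1 i = ω.1 i} = Set.Iic k := by
    ext n
    refine ⟨fun hn => ?_, fun hn i hi => (h i (hi.trans hn)).symm⟩
    by_contra hlt
    exact hk (hn (k + 1) (by simpa using hlt)).symm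
  rw [commonLength, this, csSup_Iic]

theorem mem_shadow_diff {ω₀ ω : Boundary G v₀} {k : ℕ}
    (h : ω ∈ (shadow ω₀.1 k \ shadow ω₀.1 (k + 1) : Set (Boundary G v₀))) :
    commonLength ω₀ ω = k := by
  refine commonLength_eq h.1 fun he => h.2 fun i hi => ?_
  rcases Nat.lt_or_ge i (k + 1) with h1 | h1
  · exact h.1 i (by omega)
  · obtain rfl : i = k + 1 := by omega
    exact he

theorem shadow_eq_union (ω₀ : Boundary G v₀) (n : ℕ) : (shadow ω₀.1 n : Set (Boundary G v₀)) =
    {ω₀} ∪ ⋃ j, (shadow ω₀.1 (n + j) \ shadow ω₀.1 (n + j + 1)) := by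
  ext ω
  constructor
  · intro h
    by_contra hne
    rw [Set.mem_union, Set.mem_iUnion, not_or, not_exists] at hne
    have : ∀ j, ω ∈ (shadow ω₀.1 (n + j) : Set (Boundary G v₀)) := by
      intro j
      induction j with
      | zero => exact h
      | succ j ih =>
        by_contra hj
        exact hne.2 j ⟨ih, hj⟩
    exact hne.1 (Subtype.ext (funext fun m => this m m (by omega)))
  · rintro (rfl | h)
    · exact fun i _ => rfl
    · obtain ⟨j, hj⟩ := Set.mem_iUnion.1 h
      exact fun i hi => hj.1 i (by omega)

theorem measurableSet_shadow [MeasurableSpace V] [DiscreteMeasurableSpace V] (a : ℕ → V) (n : ℕ) :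
    MeasurableSet (shadow a n : Set (Boundary G v₀)) :=
  measurable_subtype_coe (measurableSet_initialCylinder a n)

end Shadows

section UniformEnds

variable (G : SimpleGraph V) [G.LocallyFinite] {q : ℕ} (hq : 2 ≤ q) [hG : IsHomogeneousTree G q]
  (v₀ : V)

open Classical in
/-- The neighbours of `x` which are farther from `v₀` than `x`. -/
noncomputable def outward (x : V) : Finset V :=
  {y ∈ G.neighborFinset x | G.dist v₀ y = G.dist v₀ x + 1}

theorem mem_outward {G : SimpleGraph V} [G.LocallyFinite] {v₀ x y : V} :
    y ∈ outward G v₀ x ↔ G.Adj x y ∧ G.dist v₀ y = G.dist v₀ x + 1 := by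
  simp [outward]

include hG in
theorem card_outward (x : V) :
    (outward G v₀ x).card = if G.dist v₀ x = 0 then q + 1 else q := by
  classical
  split_ifs with h
  · rw [← hG.regular x, ← SimpleGraph.card_neighborFinset_eq_degree]
    congr 1
    ext y
    rw [mem_outward, SimpleGraph.mem_neighborFinset, and_iff_left_iff_imp]
    intro hy
    obtain rfl := hG.isTree.connected.dist_eq_zero_iff.1 h
    rw [SimpleGraph.dist_eq_one_iff_adj.2 hy, SimpleGraph.dist_self]
  · obtain ⟨n, hn⟩ := Nat.exists_eq_succ_of_ne_zero h
    rw [G.dist_comm] at hn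
    obtain ⟨z, hz, hd⟩ := exists_adj_dist hG.isTree.connected hn
    have : outward G v₀ x = (G.neighborFinset x).erase z := by
      ext y
      rw [mem_outward, Finset.mem_erase, SimpleGraph.mem_neighborFinset, and_comm]
      refine and_congr_left fun hy => ⟨?_, fun hne => ?_⟩
      · rintro h1 rfl
        rw [G.dist_comm, hd, G.dist_comm, hn] at h1
        omega
      · rw [G.dist_comm, G.dist_comm (u := v₀)]
        rcases dist_adj_dichotomy hG.isTree v₀ hy with h1 | h1
        · exact absurd (eq_of_adj_of_dist_eq hG.isTree hy hz h1 (by omega)) hne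
        · exact h1
    rw [this, Finset.card_erase_of_mem (by simpa using hz),
      SimpleGraph.card_neighborFinset_eq_degree, hG.regular x, Nat.add_sub_cancel]

include hq hG in
theorem outward_nonempty (x : V) : (outward G v₀ x).Nonempty := by
  rw [← Finset.card_pos, card_outward G (q := q)]
  split_ifs <;> omega

variable [MeasurableSpace V] [DiscreteMeasurableSpace V]

/-- The law of the walk which moves to a uniformly chosen neighbour farther from `v₀`. -/
noncomputable def outwardLaw : Measure (ℕ → V) :=
  chainLaw (fun x => PMF.uniformOfFinset (outward G v₀ x) (outward_nonempty G hq v₀ x)) v₀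

/-- The uniform measure on the space of ends: the law of the outward walk. -/
noncomputable def uniformEnds : Measure (Boundary G v₀) := (outwardLaw G hq v₀).comap Subtype.val

theorem ae_outwardLaw : ∀ᵐ w ∂(outwardLaw G hq v₀),
    w 0 = v₀ ∧ (∀ n, G.Adj (w n) (w (n + 1))) ∧ ∀ n, G.dist v₀ (w n) = n := by
  have := countable_vertices (G := G) (q := q) v₀
  unfold outwardLaw
  filter_upwards [chainLaw_start
    (fun x => PMF.uniformOfFinset (outward G v₀ x) (outward_nonempty G hq v₀ x)) v₀,
    ae_chainLaw_step
    (fun x => PMF.uniformOfFinset (outward G v₀ x) (outward_nonempty G hq v₀ x)) v₀] with w h0 hw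
  have hw' : ∀ n, G.Adj (w n) (w (n + 1)) ∧ G.dist v₀ (w (n + 1)) = G.dist v₀ (w n) + 1 :=
    fun n => mem_outward.1 ((PMF.mem_support_uniformOfFinset_iff _ _).1 (hw n))
  refine ⟨h0, fun n => (hw' n).1, fun n => ?_⟩
  induction n with
  | zero => rw [h0, SimpleGraph.dist_self]
  | succ n ih => rw [(hw' n).2, ih]

omit hG [G.LocallyFinite] in
theorem measurableSet_rays [Countable V] : MeasurableSet {ω : ℕ → V |
    ω 0 = v₀ ∧ (∀ n, G.Adj (ω n) (ω (n + 1))) ∧ ∀ n, G.dist v₀ (ω n) = n} := by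
  have : {ω : ℕ → V | ω 0 = v₀ ∧ (∀ n, G.Adj (ω n) (ω (n + 1))) ∧ ∀ n, G.dist v₀ (ω n) = n} =
      {ω | ω 0 = v₀} ∩ ((⋂ n, {ω | G.Adj (ω n) (ω (n + 1))}) ∩
        ⋂ n : ℕ, {ω | G.dist v₀ (ω n) = n}) := by
    ext
    simp
  rw [this]
  exact (measurableSet_coord (fun x => x = v₀) 0).inter
    ((MeasurableSet.iInter fun n => measurableSet_coord₂ G.Adj n (n + 1)).inter
      (MeasurableSet.iInter fun n => measurableSet_coord (fun x => G.dist v₀ x = n) n))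

variable {G v₀}

theorem uniformEnds_shadow (a : ℕ → V) (n : ℕ) :
    uniformEnds G hq v₀ (shadow a n) = outwardLaw G hq v₀ (initialCylinder a n) := by
  have := countable_vertices (G := G) (q := q) v₀
  refine ((MeasurableEmbedding.subtype_coe (measurableSet_rays G v₀)).comap_apply _ _).trans
    (measure_congr ?_)
  filter_upwards [ae_outwardLaw G hq v₀] with w hw
  refine propext ⟨?_, fun h => ⟨⟨w, hw⟩, h, rfl⟩⟩
  rintro ⟨ω, hω, rfl⟩
  exact hω

theorem uniformEnds_shadow_zero {a : ℕ → V} (ha : a 0 = v₀) :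
    uniformEnds G hq v₀ (shadow a 0) = 1 := by
  classical
  rw [uniformEnds_shadow, outwardLaw, chainLaw_initialCylinder_zero, if_pos ha]

theorem isProbabilityMeasure_uniformEnds (ω₀ : Boundary G v₀) :
    IsProbabilityMeasure (uniformEnds G hq v₀) :=
  ⟨by rw [← shadow_zero ω₀, uniformEnds_shadow_zero hq ω₀.2.1]⟩

theorem uniformEnds_shadow_succ {a : ℕ → V} {n : ℕ} (ha : IsGeodesicUpTo G v₀ a (n + 1)) :
    uniformEnds G hq v₀ (shadow a (n + 1)) = ENNReal.ofReal (1 / ((q + 1) * q ^ n)) := by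
  classical
  have := countable_vertices (G := G) (q := q) v₀
  have hq' : (0 : ℝ) < q := by exact_mod_cast (by omega : 0 < q)
  have hstep : ∀ m < n + 1, PMF.uniformOfFinset (outward G v₀ (a m))
      (outward_nonempty G hq v₀ (a m)) (a (m + 1)) =
        ENNReal.ofReal (1 / (if m = 0 then q + 1 else q)) := by
    intro m hm
    rw [PMF.uniformOfFinset_apply, if_pos (mem_outward.2 ⟨ha.1 m hm, by
      rw [ha.2 m hm.le, ha.2 (m + 1) hm]⟩), card_outward G (q := q), ha.2 m hm.le, one_div,
      ENNReal.ofReal_inv_of_pos (by split_ifs <;> positivity)]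
    congr 1
    split_ifs
    · exact_mod_cast (ENNReal.ofReal_natCast (q + 1)).symm
    · exact (ENNReal.ofReal_natCast q).symm
  rw [uniformEnds_shadow, outwardLaw]
  induction n with
  | zero =>
    rw [chainLaw_initialCylinder_succ, chainLaw_initialCylinder_zero,
      if_pos (ha.zero_eq hG.isTree.connected), one_mul, hstep 0 (by omega)]
    simp
  | succ n ih =>
    rw [chainLaw_initialCylinder_succ, ih (ha.mono (by omega)) fun m hm => hstep m (by omega),
      hstep (n + 1) (by omega), ← ENNReal.ofReal_mul (by positivity)]
    congr 1
    rw [if_neg (by omega), pow_succ]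
    field_simp

end UniformEnds

section Density

variable {G : SimpleGraph V} {v₀ : V}

variable [MeasurableSpace V] [DiscreteMeasurableSpace V]

theorem measurableSet_end (ω₀ : Boundary G v₀) : MeasurableSet ({ω₀} : Set (Boundary G v₀)) := by
  have : ({ω₀} : Set (Boundary G v₀)) = ⋂ n, shadow ω₀.1 n := by
    ext ω
    rw [Set.mem_iInter]
    refine ⟨?_, fun h => Subtype.ext (funext fun n => h n n le_rfl)⟩
    rintro rfl n i _
    rfl
  rw [this]
  exact MeasurableSet.iInter fun n => measurableSet_shadow ω₀.1 n

theorem measurable_commonLength (ω₀ : Boundary G v₀) : Measurable (commonLength ω₀) := by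
  refine measurable_to_countable' fun k => ?_
  have hd : ∀ k, MeasurableSet
      (shadow ω₀.1 k \ shadow ω₀.1 (k + 1) : Set (Boundary G v₀)) := fun k =>
    (measurableSet_shadow _ _).diff (measurableSet_shadow _ _)
  -- off `ω₀`, the level sets are differences of shadows
  have hcases : ∀ ω, ω = ω₀ ∨
      ω ∈ (shadow ω₀.1 (commonLength ω₀ ω) \ shadow ω₀.1 (commonLength ω₀ ω + 1) :
        Set (Boundary G v₀)) := by
    intro ω
    have hω : ω ∈ (shadow ω₀.1 0 : Set (Boundary G v₀)) := by rw [shadow_zero]; trivial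
    rw [shadow_eq_union] at hω
    refine hω.imp id fun h => ?_
    obtain ⟨j, hj⟩ := Set.mem_iUnion.1 h
    rwa [mem_shadow_diff hj]
  by_cases hk : commonLength ω₀ ω₀ = k
  · convert (hd k).union (measurableSet_end ω₀) using 1
    ext ω
    constructor
    · rintro rfl
      exact (hcases ω).symm
    · rintro (h | rfl)
      · exact mem_shadow_diff h
      · exact hk
  · convert hd k using 1
    ext ω
    constructor
    · rintro rfl
      rcases hcases ω with rfl | h
      · exact absurd rfl hk
      · exact h
    · exact fun h => mem_shadow_diff h

/-- The density of the decomposing measure. -/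
noncomputable def decompositionDensity (q : ℕ) (ω₀ : Boundary G v₀) (r : unitInterval)
    (ω : Boundary G v₀) : ENNReal :=
  ENNReal.ofReal ((1 - 2 * (r : ℝ)) * (q + 1) / (q - q * r - r) *
    (q * r / (1 - r)) ^ commonLength ω₀ ω)

theorem measurable_decompositionDensity (q : ℕ) (ω₀ : Boundary G v₀) (r : unitInterval) :
    Measurable (decompositionDensity q ω₀ r) :=
  (Measurable.of_discrete (f := fun k : ℕ => ENNReal.ofReal ((1 - 2 * (r : ℝ)) * (q + 1) /
    (q - q * r - r) * (q * r / (1 - r)) ^ k))).comp (measurable_commonLength ω₀)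

variable [G.LocallyFinite] {q : ℕ} (hq : 2 ≤ q) [hG : IsHomogeneousTree G q]

/-- The decomposing measure. -/
noncomputable def decompositionMeasure (ω₀ : Boundary G v₀) (r : unitInterval) :
    Measure (Boundary G v₀) :=
  (uniformEnds G hq v₀).withDensity (decompositionDensity q ω₀ r)

theorem decompositionMeasure_of_commonLength (ω₀ : Boundary G v₀) (r : unitInterval)
    {B : Set (Boundary G v₀)} (hB : MeasurableSet B) {k : ℕ}
    (h : ∀ ω ∈ B, commonLength ω₀ ω = k) :
    decompositionMeasure hq ω₀ r B = ENNReal.ofReal ((1 - 2 * (r : ℝ)) * (q + 1) /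
      (q - q * r - r) * (q * r / (1 - r)) ^ k) * uniformEnds G hq v₀ B := by
  rw [decompositionMeasure, withDensity_apply _ hB, ← setLIntegral_const]
  refine setLIntegral_congr_fun hB fun ω hω => ?_
  rw [decompositionDensity, h ω hω]

theorem uniformEnds_singleton (ω₀ : Boundary G v₀) : uniformEnds G hq v₀ {ω₀} = 0 := by
  have hq' : (2 : ℝ) ≤ q := by exact_mod_cast hq
  have hle : ∀ n : ℕ, uniformEnds G hq v₀ {ω₀} ≤ ENNReal.ofReal (((q : ℝ)⁻¹) ^ n) := fun n => by
    refine (measure_mono (show {ω₀} ⊆ shadow ω₀.1 (n + 1) from ?_)).trans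
      ((uniformEnds_shadow_succ hq (ω₀.isGeodesicUpTo (n + 1))).le.trans
        (ENNReal.ofReal_le_ofReal ?_))
    · rintro _ rfl i _
      rfl
    · rw [inv_pow, ← one_div]
      refine one_div_le_one_div_of_le (by positivity) ?_
      exact le_mul_of_one_le_left (by positivity) (by linarith)
  have hlim := ENNReal.tendsto_ofReal (tendsto_pow_atTop_nhds_zero_of_lt_one
    (inv_nonneg.2 (by linarith : (0 : ℝ) ≤ q)) (inv_lt_one_of_one_lt₀ (by linarith)))
  rw [ENNReal.ofReal_zero] at hlim
  exact le_antisymm (ge_of_tendsto' hlim hle) zero_le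

theorem uniformEnds_shadow_diff (ω₀ : Boundary G v₀) (n : ℕ) :
    uniformEnds G hq v₀ (shadow ω₀.1 (n + 1) \ shadow ω₀.1 (n + 2)) =
      ENNReal.ofReal ((q - 1) / ((q + 1) * q ^ (n + 1))) := by
  have := isProbabilityMeasure_uniformEnds hq ω₀
  have hq' : (2 : ℝ) ≤ q := by exact_mod_cast hq
  have hsub : (shadow ω₀.1 (n + 2) : Set (Boundary G v₀)) ⊆ shadow ω₀.1 (n + 1) :=
    fun ω h i hi => h i (by omega)
  rw [measure_sdiff hsub (measurableSet_shadow _ _).nullMeasurableSet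
    (measure_ne_top _ _), uniformEnds_shadow_succ hq (ω₀.isGeodesicUpTo _),
    uniformEnds_shadow_succ hq (ω₀.isGeodesicUpTo _), ← ENNReal.ofReal_sub _ (by positivity)]
  congr 1
  field_simp
  ring

include hq in
theorem density_denominator_pos {r : unitInterval} (hr : (r : ℝ) < 1 / 2) :
    (0 : ℝ) < q - q * r - r := by
  have hq' : (2 : ℝ) ≤ q := by exact_mod_cast hq
  have := r.2.1
  nlinarith

/-- The mass of the ends behind an edge of the ray to `ω₀`: these are sorted by their common length
with `ω₀`, which leads to a geometric series of ratio `r / (1 - r)`. -/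
theorem decompositionMeasure_shadow_ray (ω₀ : Boundary G v₀) {r : unitInterval}
    (hr : (r : ℝ) < 1 / 2) (n : ℕ) :
    decompositionMeasure hq ω₀ r (shadow ω₀.1 (n + 1)) =
      ENNReal.ofReal ((q - 1) * (1 - r) / (q - q * r - r) * (r / (1 - r)) ^ (n + 1)) := by
  have hq' : (2 : ℝ) ≤ q := by exact_mod_cast hq
  have hr0 := r.2.1
  have hs : (0 : ℝ) < 1 - r := by linarith
  have hD := density_denominator_pos hq hr
  set x : ℝ := r / (1 - r) with hx
  have hx0 : 0 ≤ x := by positivity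
  have hx1 : x < 1 := by rw [hx, div_lt_one hs]; linarith
  have hdiff : ∀ j, MeasurableSet (shadow ω₀.1 (n + 1 + j) \ shadow ω₀.1 (n + 1 + j + 1) :
      Set (Boundary G v₀)) := fun j =>
    (measurableSet_shadow _ _).diff (measurableSet_shadow _ _)
  have hz : decompositionMeasure hq ω₀ r {ω₀} = 0 :=
    withDensity_absolutelyContinuous _ _ (uniformEnds_singleton hq ω₀)
  have hdisj : Pairwise (Function.onFun Disjoint fun j =>
      (shadow ω₀.1 (n + 1 + j) \ shadow ω₀.1 (n + 1 + j + 1) : Set (Boundary G v₀))) := by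
    intro i j hij
    refine Set.disjoint_left.2 fun ω hi hj => hij ?_
    have := (mem_shadow_diff hi).symm.trans (mem_shadow_diff hj)
    omega
  rw [shadow_eq_union, measure_congr (union_ae_eq_right_of_ae_eq_empty (ae_eq_empty.2 hz)),
    measure_iUnion hdisj hdiff]
  have hterm : ∀ j, decompositionMeasure hq ω₀ r
      (shadow ω₀.1 (n + 1 + j) \ shadow ω₀.1 (n + 1 + j + 1)) =
      ENNReal.ofReal ((1 - 2 * r) * (q - 1) / (q - q * r - r) * x ^ (n + 1)) *
        ENNReal.ofReal x ^ j := fun j => by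
    rw [decompositionMeasure_of_commonLength hq ω₀ r (hdiff j) fun ω => mem_shadow_diff,
      show n + 1 + j = n + j + 1 by ring, uniformEnds_shadow_diff, ← ENNReal.ofReal_pow hx0,
      ← ENNReal.ofReal_mul (mul_nonneg (div_nonneg (mul_nonneg (by linarith) (by positivity))
        hD.le) (by positivity)),
      ← ENNReal.ofReal_mul (mul_nonneg (div_nonneg (mul_nonneg (by linarith) (by linarith))
        hD.le) (by positivity))]
    congr 1
    rw [mul_div_assoc (q : ℝ) (r : ℝ), ← hx, mul_pow]
    field_simp
    ring
  simp only [hterm]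
  rw [ENNReal.tsum_mul_left, ENNReal.tsum_geometric, ← ENNReal.ofReal_one,
    ← ENNReal.ofReal_sub _ hx0, ← ENNReal.ofReal_inv_of_pos (by linarith),
    ← ENNReal.ofReal_mul (mul_nonneg (div_nonneg (mul_nonneg (by linarith) (by linarith))
        hD.le) (by positivity))]
  congr 1
  have h1 : 1 - x = (1 - 2 * r) / (1 - r) := by
    rw [hx]
    field_simp
    ring
  have h2 : (1 - 2 * r : ℝ) ≠ 0 := by linarith
  rw [h1]
  field_simp

theorem decompositionMeasure_univ (ω₀ : Boundary G v₀) {r : unitInterval}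
    (hr : (r : ℝ) < 1 / 2) : decompositionMeasure hq ω₀ r Set.univ = 1 := by
  have := isProbabilityMeasure_uniformEnds hq ω₀
  have hq' : (2 : ℝ) ≤ q := by exact_mod_cast hq
  have hr0 := r.2.1
  have hs : (0 : ℝ) < 1 - r := by linarith
  have hD := density_denominator_pos hq hr
  have hsub : (shadow ω₀.1 1 : Set (Boundary G v₀)) ⊆ shadow ω₀.1 0 :=
    fun ω h i hi => h i (by omega)
  rw [← shadow_zero ω₀, ← measure_sdiff_add_inter _ (measurableSet_shadow ω₀.1 1),
    Set.inter_eq_right.2 hsub, decompositionMeasure_shadow_ray hq ω₀ hr 0,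
    decompositionMeasure_of_commonLength hq ω₀ r
      ((measurableSet_shadow _ _).diff (measurableSet_shadow _ _)) fun ω => mem_shadow_diff,
    measure_sdiff hsub (measurableSet_shadow _ _).nullMeasurableSet (measure_ne_top _ _),
    uniformEnds_shadow_zero hq ω₀.2.1, uniformEnds_shadow_succ hq (ω₀.isGeodesicUpTo 1),
    ← ENNReal.ofReal_one, ← ENNReal.ofReal_sub _ (by positivity), ← ENNReal.ofReal_mul
      (mul_nonneg (div_nonneg (mul_nonneg (by linarith) (by positivity)) hD.le) (by positivity)),
    ← ENNReal.ofReal_add]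
  · congr 1
    have hD' := hD.ne'
    rw [pow_zero, pow_zero, zero_add, pow_one]
    generalize hDe : (q : ℝ) - q * r - r = D at hD'
    field_simp
    rw [← hDe]
    ring
  · refine mul_nonneg (mul_nonneg (div_nonneg (mul_nonneg (by linarith) (by positivity)) hD.le)
      (by positivity)) ?_
    rw [pow_zero, mul_one, sub_nonneg, div_le_one (by positivity)]
    linarith
  · exact mul_nonneg (div_nonneg (mul_nonneg (by linarith) hs.le) hD.le) (by positivity)

end Density

/-! ### The decomposition -/

section Decomposition

variable {G : SimpleGraph V} {v₀ : V} [MeasurableSpace V] [DiscreteMeasurableSpace V]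
  [G.LocallyFinite] {q : ℕ} (hq : 2 ≤ q) [hG : IsHomogeneousTree G q]

theorem lam_geodesic_of_agree {ω : Boundary G v₀} (r : unitInterval) {a : ℕ → V} {n : ℕ}
    (h : ∀ i ≤ n, ω.1 i = a i) : lam G hq ω r (initialCylinder a n) = ENNReal.ofReal r ^ n := by
  induction n with
  | zero => rw [lam_initialCylinder_zero hq ω r (by rw [← h 0 le_rfl, ω.2.1]), pow_zero]
  | succ n ih =>
    rw [lam_initialCylinder_succ, ih fun i hi => h i (by omega), pow_succ, stepProb_toward]
    rw [← h n (by omega), ← h (n + 1) le_rfl]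
    exact isToward_ray hG.isTree.connected ω n

theorem lam_geodesic_of_branch {ω : Boundary G v₀} (r : unitInterval) {a : ℕ → V} {k : ℕ}
    (h : ∀ i ≤ k, ω.1 i = a i) (hk : ω.1 (k + 1) ≠ a (k + 1)) (m : ℕ)
    (ha : IsGeodesicUpTo G v₀ a (k + m)) :
    lam G hq ω r (initialCylinder a (k + m)) =
      ENNReal.ofReal r ^ k * ENNReal.ofReal ((1 - r) / q) ^ m := by
  induction m with
  | zero => rw [pow_zero, mul_one, add_zero, lam_geodesic_of_agree hq r h]
  | succ m ih =>
    rw [← add_assoc, lam_initialCylinder_succ, ih (ha.mono (by omega)),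
      stepProb_away r (ha.1 (k + m) (by omega)), pow_succ, mul_assoc]
    intro ht
    exact hk ((IsGeodesicUpTo.isToward_iff hG.isTree ha).1 ht (k + 1)
      (Nat.succ_le_succ (Nat.le_add_right k m)))

/-- The effect of one more edge on the integral `j` for a geodesic of length `n`: for the ends behind
the new edge, of total mass `m`, the last step has probability `s`, and for all others it has
probability `(1 - s) / q`. -/
theorem lintegral_lam_succ (ρ : Measure (Boundary G v₀)) [IsFiniteMeasure ρ] (s : unitInterval)
    {a : ℕ → V} {n : ℕ} (ha : IsGeodesicUpTo G v₀ a (n + 1)) {m j j' : ℝ} (hm : 0 ≤ m)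
    (hj : 0 ≤ j) (hρ : ρ (shadow a (n + 1)) = ENNReal.ofReal m)
    (hI : ∫⁻ ω, lam G hq ω s (initialCylinder a n) ∂ρ = ENNReal.ofReal j)
    (hj' : j' = (s : ℝ) ^ (n + 1) * m + (1 - s) / q * (j - (s : ℝ) ^ n * m)) :
    ∫⁻ ω, lam G hq ω s (initialCylinder a (n + 1)) ∂ρ = ENNReal.ofReal j' := by
  have hs0 := s.2.1
  have hs1 := sub_nonneg.2 s.2.2
  have hB := measurableSet_shadow a (n + 1) (G := G) (v₀ := v₀)
  have h1 : ∀ k ≤ n + 1, ∫⁻ ω in shadow a (n + 1), lam G hq ω s (initialCylinder a k) ∂ρ =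
      ENNReal.ofReal ((s : ℝ) ^ k * m) := fun k hk => by
    rw [ENNReal.ofReal_mul (by positivity), ← hρ, ENNReal.ofReal_pow hs0, ← setLIntegral_const]
    exact setLIntegral_congr_fun hB fun ω hω =>
      lam_geodesic_of_agree hq s fun i hi => hω i (hi.trans hk)
  have h2 : ∫⁻ ω in (shadow a (n + 1))ᶜ, lam G hq ω s (initialCylinder a (n + 1)) ∂ρ =
      (∫⁻ ω in (shadow a (n + 1))ᶜ, lam G hq ω s (initialCylinder a n) ∂ρ) *
        ENNReal.ofReal ((1 - s) / q) := by
    rw [← lintegral_mul_const _ (measurable_lam_initialCylinder hq s a n)]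
    refine setLIntegral_congr_fun hB.compl fun ω hω => ?_
    rw [lam_initialCylinder_succ, stepProb_away s (ha.1 n (by omega))]
    exact fun ht => hω ((IsGeodesicUpTo.isToward_iff hG.isTree ha).1 ht)
  rw [← lintegral_add_compl _ hB, h1 n (by omega)] at hI
  have hle : (s : ℝ) ^ n * m ≤ j := by
    rw [← ENNReal.ofReal_le_ofReal_iff hj, ← hI]
    exact le_self_add
  have h3 : ∫⁻ ω in (shadow a (n + 1))ᶜ, lam G hq ω s (initialCylinder a n) ∂ρ =
      ENNReal.ofReal (j - (s : ℝ) ^ n * m) := by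
    rw [ENNReal.ofReal_sub _ (by positivity), ← hI,
      ENNReal.add_sub_cancel_left ENNReal.ofReal_ne_top]
  rw [← lintegral_add_compl _ hB, h1 (n + 1) le_rfl, h2, h3,
    ← ENNReal.ofReal_mul (sub_nonneg.2 hle), ← ENNReal.ofReal_add (by positivity)
      (mul_nonneg (sub_nonneg.2 hle) (by positivity)), hj', mul_comm (j - _)]

/-- The density is constant on the ends behind an edge which is not on the ray to `ω₀`. -/
theorem decompositionMeasure_shadow_branch (ω₀ : Boundary G v₀) {r : unitInterval}
    (hr : (r : ℝ) < 1 / 2) {a : ℕ → V} {k n : ℕ} (hkn : k ≤ n) (h : ∀ i ≤ k, ω₀.1 i = a i)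
    (hk : ω₀.1 (k + 1) ≠ a (k + 1)) (ha : IsGeodesicUpTo G v₀ a (n + 1)) :
    decompositionMeasure hq ω₀ r (shadow a (n + 1)) =
      ENNReal.ofReal ((1 - 2 * (r : ℝ)) * (q + 1) / (q - q * r - r) *
        (q * r / (1 - r)) ^ k * (1 / ((q + 1) * q ^ n))) := by
  have hr0 := r.2.1
  have hs : (0 : ℝ) < 1 - r := by linarith
  have hD := density_denominator_pos hq hr
  rw [decompositionMeasure_of_commonLength hq ω₀ r (measurableSet_shadow a (n + 1)) (k := k),
    uniformEnds_shadow_succ hq ha, ← ENNReal.ofReal_mul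
      (mul_nonneg (div_nonneg (mul_nonneg (by linarith) (by positivity)) hD.le) (by positivity))]
  intro ω hω
  refine commonLength_eq (fun i hi => (hω i (by omega)).trans (h i hi).symm) ?_
  rw [hω (k + 1) (by omega)]
  exact hk.symm

theorem lintegral_lam_geodesic (ω₀ : Boundary G v₀) {r : unitInterval}
    (hr : (r : ℝ) < 1 / 2) {a : ℕ → V} {n : ℕ} (ha : IsGeodesicUpTo G v₀ a n) :
    ∫⁻ ω, lam G hq ω (unitInterval.symm r) (initialCylinder a n) ∂(decompositionMeasure hq ω₀ r) =
      lam G hq ω₀ r (initialCylinder a n) := by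
  have hq' : (2 : ℝ) ≤ q := by exact_mod_cast hq
  have hr0 := r.2.1
  have hs : (0 : ℝ) < 1 - r := by linarith
  have hD := density_denominator_pos hq hr
  have hsymm := unitInterval.coe_symm_eq r
  have hfin : IsProbabilityMeasure (decompositionMeasure hq ω₀ r) :=
    ⟨decompositionMeasure_univ hq ω₀ hr⟩
  induction n with
  | zero =>
    have h0 := ha.zero_eq hG.isTree.connected
    simp only [lam_initialCylinder_zero hq _ _ h0]
    rw [lintegral_one, measure_univ]
  | succ n ih =>
    specialize ih (ha.mono (by omega))
    by_cases hagree : ∀ i ≤ n + 1, ω₀.1 i = a i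
    · rw [lam_geodesic_of_agree hq r fun i hi => hagree i (by omega), ← ENNReal.ofReal_pow hr0]
        at ih ⊢
      have hρ := decompositionMeasure_shadow_ray hq ω₀ hr n
      rw [show (shadow ω₀.1 (n + 1) : Set (Boundary G v₀)) = shadow a (n + 1) from
        congrArg (Set.preimage Subtype.val) (initialCylinder_congr hagree)] at hρ
      refine lintegral_lam_succ hq _ _ ha
        (mul_nonneg (div_nonneg (mul_nonneg (by linarith) hs.le) hD.le) (by positivity))
        (by positivity) hρ ih ?_
      rw [hsymm]
      have hs' := hs.ne'
      have hD' := hD.ne'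
      rw [div_pow]
      generalize hDe : (q : ℝ) - q * r - r = D at hD'
      field_simp
      rw [← hDe]
      ring
    · obtain ⟨k, hkn, hk0, hk1⟩ : ∃ k ≤ n, (∀ i ≤ k, ω₀.1 i = a i) ∧ ω₀.1 (k + 1) ≠ a (k + 1) := by
        classical
        push Not at hagree
        have hf := Nat.find_spec hagree
        have hmin : ∀ i < Nat.find hagree, ω₀.1 i = a i := fun i hi => by
          by_contra hne
          exact Nat.find_min hagree hi ⟨by omega, hne⟩
        have hpos : Nat.find hagree ≠ 0 := fun h0 => hf.2 (by
          rw [h0, ω₀.2.1, ha.zero_eq hG.isTree.connected])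
        refine ⟨Nat.find hagree - 1, by omega, fun i hi => hmin i (by omega), ?_⟩
        rw [Nat.sub_add_cancel (by omega)]
        exact hf.2
      obtain ⟨m, rfl⟩ := Nat.exists_eq_add_of_le hkn
      rw [lam_geodesic_of_branch hq r hk0 hk1 m (ha.mono (by omega)), ← ENNReal.ofReal_pow hr0,
        ← ENNReal.ofReal_pow (by positivity), ← ENNReal.ofReal_mul (by positivity)] at ih
      rw [add_assoc, lam_geodesic_of_branch hq r hk0 hk1 (m + 1) ha, ← ENNReal.ofReal_pow hr0,
        ← ENNReal.ofReal_pow (by positivity), ← ENNReal.ofReal_mul (by positivity)]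
      refine lintegral_lam_succ hq _ _ ha
        (mul_nonneg (mul_nonneg (div_nonneg (mul_nonneg (by linarith) (by positivity)) hD.le)
          (by positivity)) (by positivity))
        (by positivity) (decompositionMeasure_shadow_branch hq ω₀ hr hkn hk0 hk1 ha) ih ?_
      rw [hsymm]
      have hs' := hs.ne'
      have hD' := hD.ne'
      rw [div_pow, div_pow, div_pow, mul_pow]
      generalize hDe : (q : ℝ) - q * r - r = D at hD'
      field_simp
      rw [← hDe]
      ring

theorem isDecomposition_decompositionMeasure (ω₀ : Boundary G v₀) {r : unitInterval}
    (hr : (r : ℝ) < 1 / 2) : IsDecomposition G hq ω₀ r (decompositionMeasure hq ω₀ r) :=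
  have : IsProbabilityMeasure (decompositionMeasure hq ω₀ r) :=
    ⟨decompositionMeasure_univ hq ω₀ hr⟩
  isDecomposition_of_geodesic hq ω₀ r _ fun _ _ ha => (lintegral_lam_geodesic hq ω₀ hr ha).symm

/-- The simple random walk is the biased walk with parameter `1 / (q + 1)`, and for this parameter
the density is constant. -/
theorem harmonicMeasure_eq_uniformEnds (ω₀ : Boundary G v₀) :
    harmonicMeasure G q v₀ = uniformEnds G hq v₀ := by
  have hq' : (2 : ℝ) ≤ q := by exact_mod_cast hq
  have hr : (simpleParameter q : ℝ) < 1 / 2 := by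
    simp only [simpleParameter]
    rw [div_lt_div_iff₀ (by positivity) (by positivity)]
    linarith
  rw [← (isDecomposition_decompositionMeasure hq ω₀ hr).eq_harmonicMeasure, decompositionMeasure]
  convert withDensity_one
  funext ω
  have e1 : (q : ℝ) * simpleParameter q / (1 - simpleParameter q) = 1 := by
    have hq0 : (q : ℝ) ≠ 0 := by linarith
    simp only [simpleParameter]
    field_simp
    rw [add_sub_cancel_right, div_self hq0]
  have e2 : (1 - 2 * (simpleParameter q : ℝ)) * (q + 1) /
      (q - q * simpleParameter q - simpleParameter q) = 1 := by
    have hD := density_denominator_pos hq hr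
    rw [div_eq_one_iff_eq hD.ne']
    simp only [simpleParameter]
    field_simp
    ring
  rw [decompositionDensity, e1, e2, one_pow, one_mul, ENNReal.ofReal_one]
  rfl

end Decomposition

/-! ### The Liouville property -/

section Liouville

/-- A bounded sequence with this convexity property cannot increase: its increments, once positive,
would stay bounded away from zero. -/
theorem nonpos_of_subharmonic {e : ℕ → ℝ} {s r K : ℝ} (hr : 0 < r) (hrs : r ≤ s) (hsum : s + r = 1)
    (h0 : e 0 ≤ 0) (hK : ∀ j, e j ≤ K) (he : ∀ j, e (j + 1) ≤ s * e j + r * e (j + 2)) (j : ℕ) :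
    e j ≤ 0 := by
  by_cases hanti : ∀ j, e (j + 1) ≤ e j
  · exact (antitone_nat_of_succ_le hanti (Nat.zero_le j)).trans h0
  exfalso
  push Not at hanti
  obtain ⟨i, hi⟩ := hanti
  have hinc : ∀ k, e (i + 1) - e i ≤ e (i + k + 1) - e (i + k) := by
    intro k
    induction k with
    | zero => exact le_rfl
    | succ k ih =>
      have h1 : e (i + (k + 1)) ≤ s * e (i + k) + r * e (i + (k + 1) + 1) := he (i + k)
      have h2 : e (i + 1) - e i ≤ e (i + (k + 1)) - e (i + k) := ih
      have h3 : s * (e (i + (k + 1)) - e (i + k)) ≤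
          r * (e (i + (k + 1) + 1) - e (i + (k + 1))) := by
        have : e (i + (k + 1)) = (s + r) * e (i + (k + 1)) := by rw [hsum, one_mul]
        linarith
      have h4 : r * (e (i + (k + 1)) - e (i + k)) ≤ s * (e (i + (k + 1)) - e (i + k)) :=
        mul_le_mul_of_nonneg_right hrs (by linarith)
      exact h2.trans (le_of_mul_le_mul_left (h4.trans h3) hr)
  have hlin : ∀ k : ℕ, e i + k * (e (i + 1) - e i) ≤ e (i + k) := by
    intro k
    induction k with
    | zero => simp
    | succ k ih =>
      have := hinc k
      push_cast
      rw [← add_assoc]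
      linarith
  obtain ⟨k, hk⟩ := exists_nat_gt ((K - e i) / (e (i + 1) - e i))
  rw [div_lt_iff₀ (by linarith)] at hk
  linarith [hlin k, hK (i + k)]

/-- The difference of a bounded harmonic function along the antidiagonals is harmonic; near its
supremum it is almost constant on large triangles, and sums up to a large difference. -/
theorem le_of_bounded_harmonic {g : ℕ → ℕ → ℝ} {s r K : ℝ} (hs : 0 < s) (hr : 0 < r)
    (hsum : s + r = 1) (hK : ∀ u d, |g u d| ≤ K)
    (hg : ∀ u d, g u d = s * g (u + 1) d + r * g u (d + 1)) (u d : ℕ) :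
    g (u + 1) d ≤ g u (d + 1) := by
  by_contra! hlt
  set D : ℕ → ℕ → ℝ := fun u d => g (u + 1) d - g u (d + 1) with hD
  have hDh : ∀ u d, D u d = s * D (u + 1) d + r * D u (d + 1) := fun u d => by
    simp only [hD]
    linarith [hg (u + 1) d, hg u (d + 1)]
  have hbdd : BddAbove (Set.range fun x : ℕ × ℕ => D x.1 x.2) := by
    refine ⟨2 * K, ?_⟩
    rintro _ ⟨x, rfl⟩
    have h1 := abs_le.1 (hK (x.1 + 1) x.2)
    have h2 := abs_le.1 (hK x.1 (x.2 + 1))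
    simp only [hD]
    linarith
  set δ := sSup (Set.range fun x : ℕ × ℕ => D x.1 x.2)
  have hle : ∀ u d, D u d ≤ δ := fun u d => le_csSup hbdd ⟨(u, d), rfl⟩
  have hδ : 0 < δ := lt_of_lt_of_le (by simp only [hD]; linarith : 0 < D u d) (hle u d)
  obtain ⟨N, hN⟩ := exists_nat_gt (2 * K / (δ / 2))
  rw [div_lt_iff₀ (by linarith)] at hN
  set c := min s r
  have hc : 0 < c := lt_min hs hr
  obtain ⟨_, ⟨⟨u₀, d₀⟩, rfl⟩, hx⟩ := exists_lt_of_lt_csSup (Set.range_nonempty _)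
    (show δ - c ^ N * (δ / 2) < δ by linarith [mul_pos (pow_pos hc N) (half_pos hδ)])
  -- the defect `δ - D` grows at most by the factor `c⁻¹` at each step
  have hdef : ∀ k i j, i + j = k →
      c ^ k * (δ - D (u₀ + i) (d₀ + j)) < c ^ N * (δ / 2) := by
    have step : ∀ u d, c * (δ - D (u + 1) d) ≤ δ - D u d ∧ c * (δ - D u (d + 1)) ≤ δ - D u d := by
      intro u d
      have h1 := hle (u + 1) d
      have h2 := hle u (d + 1)
      have h3 := hDh u d
      have h4 : c * (δ - D (u + 1) d) ≤ s * (δ - D (u + 1) d) :=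
        mul_le_mul_of_nonneg_right (min_le_left _ _) (by linarith)
      have h5 : c * (δ - D u (d + 1)) ≤ r * (δ - D u (d + 1)) :=
        mul_le_mul_of_nonneg_right (min_le_right _ _) (by linarith)
      have h6 : s * (δ - D (u + 1) d) + r * (δ - D u (d + 1)) = δ - D u d := by
        have : δ = (s + r) * δ := by rw [hsum, one_mul]
        linarith
      have h7 : 0 ≤ s * (δ - D (u + 1) d) := mul_nonneg hs.le (by linarith)
      have h8 : 0 ≤ r * (δ - D u (d + 1)) := mul_nonneg hr.le (by linarith)
      constructor <;> linarith
    intro k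
    induction k with
    | zero =>
      intro i j hij
      obtain rfl : i = 0 := by omega
      obtain rfl : j = 0 := by omega
      simp only [add_zero, pow_zero, one_mul]
      linarith
    | succ k ih =>
      intro i j hij
      rcases Nat.eq_zero_or_pos i with hi | hi
      · obtain ⟨j, rfl⟩ := Nat.exists_eq_succ_of_ne_zero (show j ≠ 0 by omega)
        refine lt_of_le_of_lt ?_ (ih i j (by omega))
        rw [pow_succ, mul_assoc]
        exact mul_le_mul_of_nonneg_left (step _ (d₀ + j)).2 (by positivity)
      · obtain ⟨i, rfl⟩ := Nat.exists_eq_succ_of_ne_zero hi.ne'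
        refine lt_of_le_of_lt ?_ (ih i j (by omega))
        rw [pow_succ, mul_assoc]
        exact mul_le_mul_of_nonneg_left (step (u₀ + i) _).1 (by positivity)
  have hlarge : ∀ i j, i + j = N → δ / 2 < D (u₀ + i) (d₀ + j) := fun i j hij => by
    have := lt_of_mul_lt_mul_left (hdef N i j hij) (by positivity)
    linarith
  have htel : ∀ j i, i + j = N + 1 →
      g (u₀ + i) (d₀ + j) + j * (δ / 2) ≤ g (u₀ + (N + 1)) d₀ := by
    intro j
    induction j with
    | zero =>
      intro i hi
      obtain rfl : i = N + 1 := by omega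
      simp
    | succ j ih =>
      intro i hi
      have h1 := ih (i + 1) (by omega)
      have h2 := hlarge i j (by omega)
      simp only [hD] at h2
      push_cast
      rw [← add_assoc] at h1 ⊢
      linarith
  have h1 := htel (N + 1) 0 (by omega)
  have h2 := abs_le.1 (hK (u₀ + 0) (d₀ + (N + 1)))
  have h3 := abs_le.1 (hK (u₀ + (N + 1)) d₀)
  push_cast at h1
  linarith

/-- Bounded space-time harmonic functions of a nondegenerate random walk on `ℕ` with steps
`0` and `1` are constant. -/
theorem eq_of_bounded_harmonic {g : ℕ → ℕ → ℝ} {s r K : ℝ} (hs : 0 < s) (hr : 0 < r)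
    (hsum : s + r = 1) (hK : ∀ u d, |g u d| ≤ K)
    (hg : ∀ u d, g u d = s * g (u + 1) d + r * g u (d + 1)) (u d : ℕ) : g u d = g 0 0 := by
  have heq : ∀ u d, g (u + 1) d = g u (d + 1) := fun u d =>
    le_antisymm (le_of_bounded_harmonic hs hr hsum hK hg u d)
      (le_of_bounded_harmonic (g := fun u d => g d u) hr hs (by linarith) (fun u d => hK d u)
        (fun u d => by linarith [hg d u]) d u)
  have h1 : ∀ u d, g u (d + 1) = g u d := fun u d => by
    have : g u (d + 1) = (s + r) * g u (d + 1) := by rw [hsum, one_mul]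
    linarith [hg u d, congrArg (s * ·) (heq u d)]
  have hd : ∀ d u, g u d = g u 0 := by
    intro d
    induction d with
    | zero => exact fun _ => rfl
    | succ d ih => exact fun u => (h1 u d).trans (ih u)
  rw [hd]
  induction u with
  | zero => rfl
  | succ u ih => rw [heq u 0, h1, ih]

variable {G : SimpleGraph V} [G.LocallyFinite] {q : ℕ} (hq : 2 ≤ q)
  [hG : IsHomogeneousTree G q] {v₀ : V}

omit [G.LocallyFinite] in
theorem towardStep_of_away (hT : G.IsTree) (ω : Boundary G v₀) {x y : V} (h : G.Adj x y)
    (hy : y ≠ towardStep hT.connected ω x) : towardStep hT.connected ω y = x :=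
  ((isToward_iff hT).1 (isToward_symm hT h fun h' => hy ((isToward_iff hT).1 h'))).symm

open Classical in
/-- The neighbours of `x` other than the one towards `ω`. -/
noncomputable def awayNeighbors (hT : G.IsTree) (ω : Boundary G v₀) (x : V) : Finset V :=
  (G.neighborFinset x).erase (towardStep hT.connected ω x)

theorem mem_awayNeighbors (hT : G.IsTree) {ω : Boundary G v₀} {x y : V} :
    y ∈ awayNeighbors hT ω x ↔ G.Adj x y ∧ y ≠ towardStep hT.connected ω x := by
  classical
  simp [awayNeighbors, and_comm]

theorem card_awayNeighbors (ω : Boundary G v₀) (x : V) :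
    (awayNeighbors hG.isTree ω x).card = q := by
  classical
  rw [awayNeighbors, Finset.card_erase_of_mem (by
    simpa using (isToward_towardStep hG.isTree.connected ω x).1),
    SimpleGraph.card_neighborFinset_eq_degree, hG.regular x, Nat.add_sub_cancel]

/-- There is a walk with `n` edges from `v₀` to `x`. -/
def IsReachableIn (G : SimpleGraph V) (v₀ : V) (n : ℕ) (x : V) : Prop :=
  ∃ p : G.Walk v₀ x, p.length = n

omit [G.LocallyFinite] in
theorem IsReachableIn.step {n : ℕ} {x y : V} (h : IsReachableIn G v₀ n x) (hxy : G.Adj x y) :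
    IsReachableIn G v₀ (n + 1) y := by
  obtain ⟨p, rfl⟩ := h
  exact ⟨p.concat hxy, p.length_concat hxy⟩

/-- `f` is space-time harmonic for the walk with drift towards `ω`. -/
def IsSpaceTimeHarmonic (hT : G.IsTree) (q : ℕ) (ω : Boundary G v₀) (s : ℝ) (f : ℕ → V → ℝ) :
    Prop :=
  ∀ n x, IsReachableIn G v₀ n x → f n x = s * f (n + 1) (towardStep hT.connected ω x) +
    (1 - s) / q * ∑ y ∈ awayNeighbors hT ω x, f (n + 1) y

include hq in
/-- A bounded space-time harmonic function takes the same values at two vertices whose paths to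
`ω` merge after the same number of steps. -/
theorem IsSpaceTimeHarmonic.eq_of_iterate {ω : Boundary G v₀} {s K : ℝ} (hs : 1 / 2 < s)
    (hs1 : s < 1) {f : ℕ → V → ℝ} (hf : IsSpaceTimeHarmonic hG.isTree q ω s f)
    (hK : ∀ n x, IsReachableIn G v₀ n x → |f n x| ≤ K) {n j : ℕ} {x y : V}
    (hx : IsReachableIn G v₀ n x) (hy : IsReachableIn G v₀ n y)
    (hxy : (towardStep hG.isTree.connected ω)^[j] x = (towardStep hG.isTree.connected ω)^[j] y) :
    f n x = f n y := by
  have hq' : (q : ℝ) ≠ 0 := Nat.cast_ne_zero.2 (by omega)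
  set t := towardStep hG.isTree.connected ω with ht
  have hadj : ∀ x, G.Adj x (t x) := fun x => (isToward_towardStep hG.isTree.connected ω x).1
  -- `e j` is the largest difference of values at vertices whose paths merge after `j` steps
  let S : ℕ → Set ℝ := fun j => {a | ∃ n x y, IsReachableIn G v₀ n x ∧ IsReachableIn G v₀ n y ∧
    t^[j] x = t^[j] y ∧ a = f n x - f n y}
  have hroot : IsReachableIn G v₀ 0 v₀ := ⟨.nil, rfl⟩
  have hne : ∀ j, (S j).Nonempty := fun j => ⟨_, 0, v₀, v₀, hroot, hroot, rfl, rfl⟩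
  have hub : ∀ j, ∀ a ∈ S j, a ≤ 2 * K := by
    rintro j _ ⟨n, x, y, hx, hy, -, rfl⟩
    have h1 := abs_le.1 (hK n x hx)
    have h2 := abs_le.1 (hK n y hy)
    linarith
  have hle : ∀ {n j x y}, IsReachableIn G v₀ n x → IsReachableIn G v₀ n y → t^[j] x = t^[j] y →
      f n x - f n y ≤ sSup (S j) := fun {n j x y} hx hy h =>
    le_csSup ⟨2 * K, hub j⟩ ⟨n, x, y, hx, hy, h, rfl⟩
  have hkey : ∀ j, sSup (S j) ≤ 0 := by
    refine nonpos_of_subharmonic (r := 1 - s) (s := s) (by linarith) (by linarith) (by ring) ?_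
      (fun j => csSup_le (hne j) (hub j)) fun j => csSup_le (hne _) ?_
    · refine csSup_le (hne 0) ?_
      rintro _ ⟨n, x, y, -, -, h, rfl⟩
      have h' : x = y := h
      rw [h', sub_self]
    · rintro _ ⟨n, x, y, hx, hy, h, rfl⟩
      have hnonempty : ∀ x, (awayNeighbors hG.isTree ω x).Nonempty := fun x => by
        rw [← Finset.card_pos, card_awayNeighbors (q := q)]
        omega
      have haway : ∀ {x c}, c ∈ awayNeighbors hG.isTree ω x → G.Adj x c ∧ t c = x :=
        fun {x c} hc => ⟨((mem_awayNeighbors _).1 hc).1,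
          towardStep_of_away hG.isTree ω ((mem_awayNeighbors _).1 hc).1
            ((mem_awayNeighbors _).1 hc).2⟩
      obtain ⟨c, hc, hcmax⟩ := Finset.exists_max_image _ (f (n + 1)) (hnonempty x)
      obtain ⟨c', hc', hcmin⟩ := Finset.exists_min_image _ (f (n + 1)) (hnonempty y)
      have h1 : ∑ z ∈ awayNeighbors hG.isTree ω x, f (n + 1) z ≤ q * f (n + 1) c := by
        have := Finset.sum_le_card_nsmul _ _ _ hcmax
        rwa [card_awayNeighbors (q := q), nsmul_eq_mul] at this
      have h2 : q * f (n + 1) c' ≤ ∑ z ∈ awayNeighbors hG.isTree ω y, f (n + 1) z := by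
        have := Finset.card_nsmul_le_sum _ _ _ hcmin
        rwa [card_awayNeighbors (q := q), nsmul_eq_mul] at this
      have h3 : f (n + 1) c - f (n + 1) c' ≤ sSup (S (j + 2)) := by
        refine hle (hx.step (haway hc).1) (hy.step (haway hc').1) ?_
        rw [Function.iterate_succ_apply, Function.iterate_succ_apply t _ c', (haway hc).2,
          (haway hc').2]
        exact h
      have h4 : f (n + 1) (t x) - f (n + 1) (t y) ≤ sSup (S j) :=
        hle (hx.step (hadj x)) (hy.step (hadj y)) h
      rw [hf n x hx, hf n y hy, ← ht]
      have h5 : (1 - s) / q * (∑ z ∈ awayNeighbors hG.isTree ω x, f (n + 1) z -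
          ∑ z ∈ awayNeighbors hG.isTree ω y, f (n + 1) z) ≤
          (1 - s) / q * (q * sSup (S (j + 2))) := by
        refine mul_le_mul_of_nonneg_left ?_ (div_nonneg (by linarith) (Nat.cast_nonneg q))
        have := mul_le_mul_of_nonneg_left h3 (Nat.cast_nonneg (α := ℝ) q)
        linarith
      rw [← mul_assoc, div_mul_cancel₀ _ hq'] at h5
      have h6 := mul_le_mul_of_nonneg_left h4 (show 0 ≤ s by linarith)
      linarith
  have h1 := (hle hx hy hxy).trans (hkey j)
  have h2 := (hle hy hx hxy.symm).trans (hkey j)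
  linarith

include hq in
/-- The Liouville property of the walk with drift towards `ω`. -/
theorem IsSpaceTimeHarmonic.eq_const {ω : Boundary G v₀} {s K : ℝ} (hs : 1 / 2 < s)
    (hs1 : s < 1) {f : ℕ → V → ℝ} (hf : IsSpaceTimeHarmonic hG.isTree q ω s f)
    (hK : ∀ n x, IsReachableIn G v₀ n x → |f n x| ≤ K) {n : ℕ} {x : V}
    (hx : IsReachableIn G v₀ n x) : f n x = f 0 v₀ := by
  have hq' : (q : ℝ) ≠ 0 := Nat.cast_ne_zero.2 (by omega)
  set t := towardStep hG.isTree.connected ω with ht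
  have hadj : ∀ x, G.Adj x (t x) := fun x => (isToward_towardStep hG.isTree.connected ω x).1
  have hchild : ∀ x, ∃ y, y ∈ awayNeighbors hG.isTree ω x := fun x => by
    refine Finset.card_pos.1 ?_
    rw [card_awayNeighbors (q := q)]
    omega
  choose c hc using hchild
  have haway : ∀ {x y}, y ∈ awayNeighbors hG.isTree ω x → G.Adj x y ∧ t y = x :=
    fun {x y} hy => ⟨((mem_awayNeighbors _).1 hy).1,
      towardStep_of_away hG.isTree ω ((mem_awayNeighbors _).1 hy).1
        ((mem_awayNeighbors _).1 hy).2⟩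
  have htc : ∀ d x, t^[d] (c^[d] x) = x :=
    fun d => Function.LeftInverse.iterate (fun x => (haway (hc x)).2) d
  -- `c^[d] (ω u)` is reached from `v₀` by `u` steps towards `ω` followed by `d` steps away
  have hreach : ∀ u d, IsReachableIn G v₀ (u + d) (c^[d] (ω.1 u)) := by
    intro u d
    induction d with
    | zero =>
      induction u with
      | zero => exact ⟨(SimpleGraph.Walk.nil).copy rfl ω.2.1.symm, by simp⟩
      | succ u ih => exact ih.step (ω.2.2.1 u)
    | succ d ih =>
      rw [Function.iterate_succ_apply']
      exact ih.step (haway (hc _)).1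
  have hcanon : ∀ u d, f (u + d) (c^[d] (ω.1 u)) = f (0 + 0) (c^[0] (ω.1 0)) := by
    refine eq_of_bounded_harmonic (g := fun u d => f (u + d) (c^[d] (ω.1 u))) (s := s)
      (r := 1 - s) (by linarith) (by linarith) (by ring) (fun u d => hK _ _ (hreach u d)) ?_
    intro u d
    have h1 : f (u + d + 1) (t (c^[d] (ω.1 u))) = f (u + 1 + d) (c^[d] (ω.1 (u + 1))) := by
      have e : u + d + 1 = u + 1 + d := by ring
      have hr := (hreach u d).step (hadj _)
      rw [e] at hr ⊢
      refine hf.eq_of_iterate hq hs hs1 hK hr (hreach (u + 1) d) (j := d) ?_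
      rw [← ht, htc, ← Function.iterate_succ_apply, Function.iterate_succ_apply', htc, ht,
        towardStep_ray hG.isTree]
    have h2 : ∀ y ∈ awayNeighbors hG.isTree ω (c^[d] (ω.1 u)),
        f (u + d + 1) y = f (u + (d + 1)) (c^[d + 1] (ω.1 u)) := fun y hy => by
      refine hf.eq_of_iterate hq hs hs1 hK ((hreach u d).step (haway hy).1) (hreach u (d + 1))
        (j := 1) ?_
      rw [Function.iterate_one, Function.iterate_succ_apply', ← ht, (haway hy).2,
        (haway (hc _)).2]
    rw [hf _ _ (hreach u d), ← ht, h1, Finset.sum_congr rfl h2, Finset.sum_const,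
      card_awayNeighbors (q := q), nsmul_eq_mul, ← mul_assoc, div_mul_cancel₀ _ hq']
  obtain ⟨p, rfl⟩ := hx
  have hmerge : ∀ i ≤ p.length, ∃ u d j, u + d = i ∧
      t^[j] (p.getVert i) = t^[j] (c^[d] (ω.1 u)) := by
    intro i
    induction i with
    | zero => exact fun _ => ⟨0, 0, 0, rfl, by rw [p.getVert_zero]; exact ω.2.1.symm⟩
    | succ i ih =>
      intro hi
      obtain ⟨u, d, j, hud, hj⟩ := ih (by omega)
      by_cases hz : p.getVert (i + 1) = t (p.getVert i)
      · refine ⟨u + 1, d, j + d, by omega, ?_⟩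
        calc t^[j + d] (p.getVert (i + 1)) = t^[d + 1 + j] (p.getVert i) := by
              rw [hz, ← Function.iterate_succ_apply, show (j + d).succ = d + 1 + j by omega]
          _ = t^[j + 1] (t^[d] (c^[d] (ω.1 u))) := by
              rw [Function.iterate_add_apply, hj, ← Function.iterate_add_apply,
                ← Function.iterate_add_apply]
              congr 1
              ring_nf
          _ = t^[j] (t^[d] (c^[d] (ω.1 (u + 1)))) := by
              rw [htc, htc, Function.iterate_succ_apply, ht, towardStep_ray hG.isTree]
          _ = t^[j + d] (c^[d] (ω.1 (u + 1))) := (Function.iterate_add_apply _ _ _ _).symm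
      · refine ⟨u, d + 1, j + 1, by omega, ?_⟩
        rw [Function.iterate_succ_apply, Function.iterate_succ_apply t,
          Function.iterate_succ_apply' c, (haway (hc _)).2, ← hj]
        congr 1
        exact towardStep_of_away hG.isTree ω (p.adj_getVert_succ (by omega)) hz
  obtain ⟨u, d, j, hud, hj⟩ := hmerge p.length le_rfl
  rw [SimpleGraph.Walk.getVert_length] at hj
  have := hf.eq_of_iterate hq hs hs1 hK ⟨p, rfl⟩ (hud ▸ hreach u d) hj
  rw [this, ← hud, hcanon]
  rw [Function.iterate_zero_apply, ω.2.1]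

end Liouville

/-! ### Ergodicity -/

section Ergodicity

variable {G : SimpleGraph V} {v₀ : V}

theorem getVert_concat_of_le {x y : V} (p : G.Walk v₀ x) (h : G.Adj x y) {i : ℕ}
    (hi : i ≤ p.length) : (p.concat h).getVert i = p.getVert i := by
  rw [SimpleGraph.Walk.concat_eq_append, SimpleGraph.Walk.getVert_append]
  split_ifs with hlt
  · rfl
  · obtain rfl : i = p.length := by omega
    simp

theorem getVert_concat_last {x y : V} (p : G.Walk v₀ x) (h : G.Adj x y) :
    (p.concat h).getVert (p.length + 1) = y := by
  rw [← SimpleGraph.Walk.length_concat p h, SimpleGraph.Walk.getVert_length]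

theorem cylinder_concat {x y : V} (p : G.Walk v₀ x) (h : G.Adj x y) :
    cylinder (p.concat h) = cylinder p ∩ {w | w (p.length + 1) = y} := by
  rw [cylinder_eq, cylinder_eq, SimpleGraph.Walk.length_concat, initialCylinder_succ,
    getVert_concat_last, initialCylinder_congr fun i hi => getVert_concat_of_le p h hi]

theorem exists_walk_of_path {a : ℕ → V} (h0 : a 0 = v₀) {n : ℕ}
    (h : ∀ i < n, G.Adj (a i) (a (i + 1))) :
    ∃ p : G.Walk v₀ (a n), p.length = n ∧ cylinder p = initialCylinder a n := by
  induction n with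
  | zero =>
    subst h0
    exact ⟨.nil, rfl, initialCylinder_congr fun i hi => by rw [Nat.le_zero.1 hi]; rfl⟩
  | succ n ih =>
    obtain ⟨p, hp, hc⟩ := ih fun i hi => h i (by omega)
    refine ⟨p.concat (h n (by omega)), by rw [SimpleGraph.Walk.length_concat, hp], ?_⟩
    rw [cylinder_concat, hc, hp, initialCylinder_succ]

variable [MeasurableSpace V] [DiscreteMeasurableSpace V] [G.LocallyFinite]

omit [G.LocallyFinite] in
theorem measurableSet_cylinder {x : V} (p : G.Walk v₀ x) : MeasurableSet (cylinder p) :=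
  measurableSet_initialCylinder _ _

theorem IsCentral.measureReal_cylinder_eq_sum {ν : Measure (ℕ → V)} (hν : IsCentral G v₀ ν) {x : V}
    (p : G.Walk v₀ x) : ν.real (cylinder p) =
      ∑ y ∈ G.neighborFinset x, ν.real (cylinder p ∩ {w | w (p.length + 1) = y}) := by
  have := hν.isProbabilityMeasure
  rw [← measureReal_biUnion_finset]
  · refine measureReal_congr ?_
    filter_upwards [hν.ae_mem] with w hw
    refine propext ⟨fun h => ?_, fun h => ?_⟩
    · have hx : w p.length = x := (h p.length le_rfl).trans p.getVert_length
      refine Set.mem_biUnion (x := w (p.length + 1)) ?_ ⟨h, rfl⟩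
      have := hw.2 p.length
      rw [hx] at this
      simpa using this
    · obtain ⟨y, -, hy⟩ := Set.mem_iUnion₂.1 h
      exact hy.1
  · intro y _ z _ hyz
    exact Set.disjoint_left.2 fun w h1 h2 => hyz (h1.2.symm.trans h2.2)
  · exact fun y _ => (measurableSet_cylinder p).inter (measurableSet_coord (fun z => z = y) _)

variable {q : ℕ} (hq : 2 ≤ q) [hG : IsHomogeneousTree G q]

/-- The density on paths of length `n` ending at `x` of a central measure with respect to
another one; by centrality, it does not depend on the choice of the path. -/
noncomputable def pathDensity (G : SimpleGraph V) (v₀ : V) (ν μ : Measure (ℕ → V)) (n : ℕ) (x : V) :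
    ℝ :=
  open Classical in
  if h : IsReachableIn G v₀ n x then ν.real (cylinder h.choose) / μ.real (cylinder h.choose) else 0

omit [DiscreteMeasurableSpace V] [G.LocallyFinite] in
theorem pathDensity_eq {ν μ : Measure (ℕ → V)} (hν : IsCentral G v₀ ν) (hμ : IsCentral G v₀ μ)
    {x : V} (p : G.Walk v₀ x) :
    pathDensity G v₀ ν μ p.length x = ν.real (cylinder p) / μ.real (cylinder p) := by
  have h : IsReachableIn G v₀ p.length x := ⟨p, rfl⟩
  rw [pathDensity, dif_pos h, measureReal_def, measureReal_def, measureReal_def, measureReal_def,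
    hν.uniform x _ p h.choose_spec, hμ.uniform x _ p h.choose_spec]

theorem lam_cylinder_pos (ω : Boundary G v₀) {s : unitInterval} (hs0 : (0 : ℝ) < s)
    (hs1 : (s : ℝ) < 1) {x : V} (p : G.Walk v₀ x) : 0 < (lam G hq ω s).real (cylinder p) := by
  have hq' : (0 : ℝ) < q := by exact_mod_cast (by omega : 0 < q)
  obtain ⟨u, d, -, -, h⟩ := lam_initialCylinder_eq hq ω p.getVert_zero p.length
    fun i hi => p.adj_getVert_succ hi
  have hr : (0 : ℝ) < (1 - s) / q := div_pos (by linarith) hq'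
  rw [measureReal_def, cylinder_eq, h, ← ENNReal.ofReal_pow hs0.le, ← ENNReal.ofReal_pow hr.le,
    ← ENNReal.ofReal_mul (by positivity), ENNReal.toReal_ofReal (by positivity)]
  positivity

theorem lam_cylinder_inter (ω : Boundary G v₀) (s : unitInterval) {x y : V} (p : G.Walk v₀ x)
    (h : G.Adj x y) : lam G hq ω s (cylinder p ∩ {w | w (p.length + 1) = y}) =
      lam G hq ω s (cylinder p) * stepProb G q ω s x y := by
  rw [← cylinder_concat p h, cylinder_eq, cylinder_eq, SimpleGraph.Walk.length_concat,
    lam_initialCylinder_succ, getVert_concat_last, getVert_concat_of_le p h le_rfl,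
    SimpleGraph.Walk.getVert_length,
    initialCylinder_congr fun i hi => getVert_concat_of_le p h hi]

theorem isSpaceTimeHarmonic_pathDensity {ν : Measure (ℕ → V)} (hν : IsCentral G v₀ ν)
    (ω : Boundary G v₀) {s : unitInterval} (hs0 : (0 : ℝ) < s) (hs1 : (s : ℝ) < 1) :
    IsSpaceTimeHarmonic hG.isTree q ω s (pathDensity G v₀ ν (lam G hq ω s)) := by
  classical
  rintro n x ⟨p, rfl⟩
  set μ := lam G hq ω s
  have hμ : IsCentral G v₀ μ := isCentral_lam hq ω s
  have hpos := lam_cylinder_pos hq ω hs0 hs1 p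
  have hdens : ∀ y, G.Adj x y → ν.real (cylinder p ∩ {w | w (p.length + 1) = y}) =
      pathDensity G v₀ ν μ (p.length + 1) y *
        (μ.real (cylinder p) * (stepProb G q ω s x y).toReal) := fun y hy => by
    have h1 : μ.real (cylinder (p.concat hy)) =
        μ.real (cylinder p) * (stepProb G q ω s x y).toReal := by
      rw [cylinder_concat, measureReal_def, lam_cylinder_inter hq ω s p hy, ENNReal.toReal_mul]
      rfl
    have h2 := pathDensity_eq hν hμ (p.concat hy)
    rw [SimpleGraph.Walk.length_concat] at h2
    rw [h2, ← h1, ← cylinder_concat p hy,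
      div_mul_cancel₀ _ (lam_cylinder_pos hq ω hs0 hs1 (p.concat hy)).ne']
  have ht := isToward_towardStep hG.isTree.connected ω x
  rw [pathDensity_eq hν hμ p, div_eq_iff hpos.ne', hν.measureReal_cylinder_eq_sum p,
    ← Finset.add_sum_erase _ _ (show towardStep hG.isTree.connected ω x ∈ G.neighborFinset x by
      simpa using ht.1), hdens _ ht.1, stepProb_toward s ht, ENNReal.toReal_ofReal hs0.le, add_mul,
    Finset.mul_sum, Finset.sum_mul]
  congr 1
  · ring
  · refine Finset.sum_congr (by rw [awayNeighbors]) fun y hy => ?_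
    rw [mem_awayNeighbors] at hy
    rw [hdens y hy.1, stepProb_away s hy.1 fun h => hy.2 ((isToward_iff hG.isTree).1 h),
      ENNReal.toReal_ofReal (div_nonneg (by linarith) (Nat.cast_nonneg q))]
    ring

/-- Among the central measures, only `λ_{ω,s}` itself is bounded by a multiple of `λ_{ω,s}`. -/
theorem IsCentral.eq_lam_of_le {ν : Measure (ℕ → V)} (hν : IsCentral G v₀ ν)
    (ω : Boundary G v₀) {s : unitInterval} (hs : (1 / 2 : ℝ) < s) {K : NNReal}
    (hle : ν ≤ K • lam G hq ω s) : ν = lam G hq ω s := by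
  have := countable_vertices (G := G) (q := q) v₀
  have := hν.isProbabilityMeasure
  have hac : ν ≪ lam G hq ω s :=
    (Measure.absolutelyContinuous_of_le hle).trans (Measure.smul_absolutelyContinuous (c := K))
  refine measure_ext_initialCylinder fun a n => ?_
  by_cases ha : a 0 = v₀ ∧ ∀ i < n, G.Adj (a i) (a (i + 1))
  swap
  · rw [lam_initialCylinder_eq_zero hq ω s ha, hac (lam_initialCylinder_eq_zero hq ω s ha)]
  rcases eq_or_lt_of_le s.2.2 with hs1 | hs1
  · -- the walk is deterministic: every cylinder has mass `0` or `1`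
    obtain ⟨u, d, -, -, h⟩ := lam_initialCylinder_eq hq ω ha.1 n ha.2
    specialize h s
    rw [hs1, sub_self, zero_div, ENNReal.ofReal_one, ENNReal.ofReal_zero, one_pow, one_mul] at h
    rcases Nat.eq_zero_or_pos d with rfl | hd
    · rw [pow_zero] at h
      rw [h]
      rw [← prob_compl_eq_zero_iff (measurableSet_initialCylinder a n)] at h ⊢
      exact hac h
    · rw [zero_pow hd.ne'] at h
      rw [h, hac h]
  · have hs0 : (0 : ℝ) < s := by linarith
    have hμ := isCentral_lam (G := G) hq ω s
    have hbound : ∀ n x, IsReachableIn G v₀ n x →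
        |pathDensity G v₀ ν (lam G hq ω s) n x| ≤ K := by
      rintro n x ⟨p, rfl⟩
      rw [pathDensity_eq hν hμ, abs_of_nonneg (by positivity),
        div_le_iff₀ (lam_cylinder_pos hq ω hs0 hs1 p)]
      have h1 := ENNReal.toReal_mono (by
        rw [Measure.smul_apply]
        exact ENNReal.mul_ne_top ENNReal.coe_ne_top (measure_ne_top _ _)) (hle (cylinder p))
      rw [Measure.smul_apply, ENNReal.smul_def, smul_eq_mul, ENNReal.toReal_mul] at h1
      exact h1
    obtain ⟨p, -, hp⟩ := exists_walk_of_path ha.1 ha.2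
    have hconst := (isSpaceTimeHarmonic_pathDensity hq hν ω hs0 hs1).eq_const hq hs hs1 hbound
      ⟨p, rfl⟩
    have hnil : ∀ μ : Measure (ℕ → V), IsCentral G v₀ μ →
        μ.real (cylinder (.nil : G.Walk v₀ v₀)) = 1 := fun μ hμ => by
      have := hμ.isProbabilityMeasure
      rw [← probReal_univ (μ := μ)]
      refine measureReal_congr ?_
      filter_upwards [hμ.ae_mem] with w hw
      refine eq_true ?_ |>.trans (eq_true (Set.mem_univ w)).symm
      intro i hi
      rw [Nat.le_zero.1 hi]
      exact hw.1
    have h0 := pathDensity_eq hν hμ (.nil : G.Walk v₀ v₀)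
    rw [hnil ν hν, hnil _ hμ, div_one] at h0
    rw [pathDensity_eq hν hμ, show (0 : ℕ) = (.nil : G.Walk v₀ v₀).length from rfl, h0,
      div_eq_one_iff_eq (lam_cylinder_pos hq ω hs0 hs1 p).ne'] at hconst
    rw [← hp]
    exact (measureReal_eq_measureReal_iff).1 hconst

theorem isErgodicCentral_lam (ω : Boundary G v₀) {s : unitInterval} (hs : (1 / 2 : ℝ) < s) :
    IsErgodicCentral G v₀ (lam G hq ω s) := by
  rw [IsErgodicCentral, Set.extremePoints]
  refine ⟨isCentral_lam hq ω s, ?_⟩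
  rintro ν hν ν' - ⟨a, b, ha, hb, -, hab⟩
  refine IsCentral.eq_lam_of_le hq hν ω hs (K := a⁻¹) ?_
  rw [← hab, smul_add, smul_smul, inv_mul_cancel₀ ha.ne', one_smul]
  exact Measure.le_add_right le_rfl

end Ergodicity

end HomTree

theorem mainTheorem4 {V : Type*} [MeasurableSpace V] [DiscreteMeasurableSpace V]
    (G : SimpleGraph V) [G.LocallyFinite] (q : ℕ) (hq : 2 ≤ q)
    [HomTree.IsHomogeneousTree G q] (v₀ : V) (ω₀ : HomTree.Boundary G v₀)
    (r : unitInterval) (hr : (r : ℝ) < 1 / 2) :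
    (∀ ω : HomTree.Boundary G v₀,
      HomTree.IsErgodicCentral G v₀ (HomTree.lam G hq ω (unitInterval.symm r))) ∧
    Measurable (fun ω : HomTree.Boundary G v₀ => HomTree.lam G hq ω (unitInterval.symm r)) ∧
    ∃ ρ : Measure (HomTree.Boundary G v₀),
      HomTree.IsDecomposition G hq ω₀ r ρ ∧
      (∀ ρ' : Measure (HomTree.Boundary G v₀),
        HomTree.IsDecomposition G hq ω₀ r ρ' → ρ' = ρ) ∧
      ρ ≪ HomTree.harmonicMeasure G q v₀ ∧
      ρ.rnDeriv (HomTree.harmonicMeasure G q v₀)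
        =ᵐ[HomTree.harmonicMeasure G q v₀] fun ω =>
          ENNReal.ofReal ((1 - 2 * (r : ℝ)) * (q + 1) / (q - q * r - r) *
            (q * r / (1 - r)) ^ HomTree.commonLength ω₀ ω) := by
  have hs : (1 / 2 : ℝ) < unitInterval.symm r := by
    rw [unitInterval.coe_symm_eq]
    linarith
  have hdec := HomTree.isDecomposition_decompositionMeasure (G := G) hq ω₀ hr
  refine ⟨fun ω => HomTree.isErgodicCentral_lam hq ω hs, HomTree.measurable_lam hq _,
    HomTree.decompositionMeasure hq ω₀ r, hdec, fun ρ' h => ?_, ?_, ?_⟩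
  · ext B hB
    rw [h.apply_eq hq hr hB, hdec.apply_eq hq hr hB]
  · rw [HomTree.harmonicMeasure_eq_uniformEnds hq ω₀]
    exact withDensity_absolutelyContinuous _ _
  · rw [HomTree.harmonicMeasure_eq_uniformEnds hq ω₀]
    have := HomTree.isProbabilityMeasure_uniformEnds (G := G) hq ω₀
    exact Measure.rnDeriv_withDensity _ (HomTree.measurable_decompositionDensity q ω₀ r)
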